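/- Let $n\ge 0$ and let $(M^{4n},g_M,I_1,I_2,I_3)$ be a hyperKähler manifold: $g_M$ is a smooth Riemannian metric, $I_1,I_2,I_3$ are smooth integrable almost complex structures (vanishing Nijenhuis tensor), $g_M$-orthogonal, with $I_iI_j=I_k=-I_jI_i$ for cyclic permutations $(i,j,k)$ of $(1,2,3)$, and the forms $\sigma_i(\cdot,\cdot)=g_M(I_i\cdot,\cdot)$ are closed. Let $\gamma_1,\dots,\gamma_4$ be smooth closed $2$-forms on $M$ that are sections of $\mathfrak{sp}(n)$, i.e. of type $(1,1)$ with respect to every almost complex structure $aI_1+bI_2+cI_3$, $a^2+b^2+c^2=1$. Let $\mathbb T^4=(\mathbb R/2\pi\mathbb Z)^4$ and let $\pi\colon P^{4n+4}\to M$ be a smooth principal $\mathbb T^4$-bundle with connection $1$-forms $\nu_1,\dots,\nu_4$ (smooth, $\mathbb T^4$-invariant, with $\nu_i(X_j)=\delta_{ij}$, where $X_j$ is the vector field generating the action of the $j$-th circle) such that $d\nu_i=\pi^*\gamma_i$. (Such $P$ and $\nu_i$ exist if and only if $[\gamma_i]\in H^2(M,2\pi\mathbb Z)$ for all $i$; $P$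 is then a $\mathbb T^4$-bundle determined by these classes.) Then the data $$\check g:=\pi^*g_M+\nu_1^2+\nu_2^2+\nu_3^2+\nu_4^2,$$ $$\check\omega_1:=\pi^*\sigma_1+\nu_1\wedge\nu_2+\nu_3\wedge\nu_4,\quad \check\omega_2:=\pi^*\sigma_2+\nu_1\wedge\nu_3+\nu_4\wedge\nu_2,\quad \check\omega_3:=\pi^*\sigma_3+\nu_1\wedge\nu_4+\nu_2\wedge\nu_3$$ define a hyper-Hermitian structure on $P$: $\check g$ is a smooth Riemannian metric, and there are smooth almost complex structures $\check I_1,\check I_2,\check I_3$ on $P$ with $\check g(\check I_i\cdot,\cdot)=\check\omega_i(\cdot,\cdot)$ that satisfy the quaternion relations, are $\check g$-orthogonal, and are all integrable (vanishing Nijenhuis tensor). In particular $P$ is hypercomplex. -/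

import Mathlib

open scoped Manifold ContDiff

noncomputable section

namespace HKTorus

section Forms

variable {E : Type*} [NormedAddCommGroup E] [NormedSpace ℝ E]
  {H : Type*} [TopologicalSpace H] (I : ModelWithCorners ℝ E H)
  {M : Type*} [TopologicalSpace M] [ChartedSpace H M]
  {E' : Type*} [NormedAddCommGroup E'] [NormedSpace ℝ E']
  {H' : Type*} [TopologicalSpace H'] (I' : ModelWithCorners ℝ E' H')
  {P : Type*} [TopologicalSpace P] [ChartedSpace H' P]

variable (M) in
/-- A (not necessarily smooth) differential `k`-form on `M`. -/
abbrev DForm (k : ℕ) : Type _ := (x : M) → (TangentSpace I x) [⋀^Fin k]→L[ℝ] ℝ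

variable (M) in
/-- A (not necessarily smooth) differential `1`-form on `M`, as a field of covectors. -/
abbrev OneForm : Type _ := (x : M) → TangentSpace I x →L[ℝ] ℝ

variable (M) in
/-- A (not necessarily smooth) field of bilinear forms on the tangent spaces of `M`. -/
abbrev BilinField : Type _ := (x : M) → TangentSpace I x →L[ℝ] TangentSpace I x →L[ℝ] ℝ

variable (M) in
/-- A (not necessarily smooth) field of endomorphisms of the tangent spaces of `M`. -/
abbrev EndField : Type _ := (x : M) → TangentSpace I x →L[ℝ] TangentSpace I x

variable {I I'}

/-- A field of covectors, regarded as an alternating form of degree one. -/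
def OneForm.toDForm (ν : OneForm I M) : DForm I M 1 := fun x =>
  ContinuousAlternatingMap.ofSubsingleton ℝ (TangentSpace I x) ℝ (0 : Fin 1) (ν x)

/-- The expression of a differential form in the preferred chart at `x₀`: the pull-back of the
form under the inverse of the chart. It is meaningful on the target of the chart. -/
def DForm.inChart {k : ℕ} (η : DForm I M k) (x₀ : M) : E → E [⋀^Fin k]→L[ℝ] ℝ := fun y =>
  (η ((extChartAt I x₀).symm y)).compContinuousLinearMap
    (mfderiv 𝓘(ℝ, E) I (extChartAt I x₀).symm y)

/-- A form is smooth if its expressions in the charts are. -/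
def DForm.IsSmooth {k : ℕ} (η : DForm I M k) : Prop :=
  ∀ x₀ : M, ContDiffOn ℝ ∞ (η.inChart x₀) (extChartAt I x₀).target

/-- The exterior derivative, computed at `x` in the preferred chart at `x`
(for manifolds without boundary). -/
def DForm.d {k : ℕ} (η : DForm I M k) : DForm I M (k + 1) := fun x =>
  (extDeriv (η.inChart x) (extChartAt I x x)).compContinuousLinearMap
    (mfderiv I 𝓘(ℝ, E) (extChartAt I x) x)

/-- A form is closed if its exterior derivative vanishes. -/
def DForm.IsClosed {k : ℕ} (η : DForm I M k) : Prop := ∀ x, η.d x = 0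

/-- The wedge product of two covectors, `(α ∧ β)(u, v) = α(u) β(v) - α(v) β(u)`
(see `wedgeCovector_apply`). -/
def wedgeCovector {V : Type*} [AddCommGroup V] [Module ℝ V] [TopologicalSpace V]
    (α β : V →L[ℝ] ℝ) : V [⋀^Fin 2]→L[ℝ] ℝ :=
  ContinuousMultilinearMap.alternatization
    ((ContinuousMultilinearMap.mkPiAlgebra ℝ (Fin 2) ℝ).compContinuousLinearMap ![α, β])

theorem wedgeCovector_apply {V : Type*} [AddCommGroup V] [Module ℝ V] [TopologicalSpace V]
    (α β : V →L[ℝ] ℝ) (u v : V) :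
    wedgeCovector α β ![u, v] = α u * β v - α v * β u := by
  have hperm : (Finset.univ : Finset (Equiv.Perm (Fin 2))) = {1, Equiv.swap 0 1} := by decide
  simp [wedgeCovector, ContinuousMultilinearMap.alternatization_apply_apply,
    Units.smul_def]
  rw [hperm, Finset.sum_pair (by decide)]
  simp
  ring

/-- The wedge product of two `1`-forms. -/
def OneForm.wedge (α β : OneForm I M) : DForm I M 2 := fun x => wedgeCovector (α x) (β x)

/-- The pull-back of a form under `f`. -/
def DForm.pullback {k : ℕ} (f : P → M) (η : DForm I M k) : DForm I' P k := fun p =>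
  (η (f p)).compContinuousLinearMap (mfderiv I' I f p)

end Forms

section HyperHermitian

variable {E : Type*} [NormedAddCommGroup E] [NormedSpace ℝ E]
  {H : Type*} [TopologicalSpace H] {I : ModelWithCorners ℝ E H}
  {M : Type*} [TopologicalSpace M] [ChartedSpace H M]

/-- `g` is a smooth Riemannian metric. -/
def IsRiemannianMetric [IsManifold I ∞ M] (g : BilinField I M) : Prop :=
  ∃ G : Bundle.ContMDiffRiemannianMetric I ∞ E (fun x : M => TangentSpace I x),
    ∀ x, G.inner x = g x

/-- The field of endomorphisms `J` is smooth, as a section of `End(TM)`. -/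
def EndField.IsSmooth [IsManifold I ∞ M] (J : EndField I M) : Prop :=
  ContMDiff I (I.prod 𝓘(ℝ, E →L[ℝ] E)) ∞
    (fun x => Bundle.TotalSpace.mk' (E →L[ℝ] E)
      (E := fun x : M => TangentSpace I x →L[ℝ] TangentSpace I x) x (J x))

/-- Integrability of an almost complex structure `J`: the Nijenhuis tensor
`N_J(X, Y) = [X, Y] + J([J X, Y] + [X, J Y]) - [J X, J Y]` vanishes. -/
def EndField.IsIntegrable [IsManifold I ∞ M] (J : EndField I M) : Prop :=
  ∀ (x : M) (X Y : (y : M) → TangentSpace I y),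
    ContMDiffAt I I.tangent ∞ (fun y => (⟨y, X y⟩ : TangentBundle I M)) x →
    ContMDiffAt I I.tangent ∞ (fun y => (⟨y, Y y⟩ : TangentBundle I M)) x →
    VectorField.mlieBracket I X Y x
      + J x (VectorField.mlieBracket I (fun y => J y (X y)) Y x
        + VectorField.mlieBracket I X (fun y => J y (Y y)) x)
      - VectorField.mlieBracket I (fun y => J y (X y)) (fun y => J y (Y y)) x = 0

/-- `(J 0, J 1, J 2)` is a hypercomplex structure: a triple of smooth integrable almost complex
structures that satisfy the quaternion relations. Indices are taken modulo three, so that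
`(i, i + 1, i + 2)` runs over the cyclic permutations of `(0, 1, 2)`. -/
structure IsHypercomplex [IsManifold I ∞ M] (J : Fin 3 → EndField I M) : Prop where
  smooth : ∀ i, (J i).IsSmooth
  sq : ∀ i x (v : TangentSpace I x), J i x (J i x v) = -v
  mul : ∀ i x (v : TangentSpace I x), J i x (J (i + 1) x v) = J (i + 2) x v
  anticomm : ∀ i x (v : TangentSpace I x), J i x (J (i + 1) x v) = -J (i + 1) x (J i x v)
  integrable : ∀ i, (J i).IsIntegrable

/-- `(g, J 0, J 1, J 2)` is a hyper-Hermitian structure with fundamental forms `η 0, η 1, η 2`: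
`J` is hypercomplex, `g` is a Riemannian metric that is Hermitian for every `J i`, and
`η i (u, v) = g (J i u, v)`. -/
structure IsHyperHermitian [IsManifold I ∞ M] (g : BilinField I M) (J : Fin 3 → EndField I M)
    (η : Fin 3 → DForm I M 2) : Prop where
  riemannian : IsRiemannianMetric g
  hypercomplex : IsHypercomplex J
  hermitian : ∀ i x (u v : TangentSpace I x), g x (J i x u) (J i x v) = g x u v
  form_eq : ∀ i x (u v : TangentSpace I x), η i x ![u, v] = g x (J i x u) v

/-- `(g, J 0, J 1, J 2)` is a hyperKähler structure with Kähler forms `σ 0, σ 1, σ 2`. -/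
structure IsHyperKahler [IsManifold I ∞ M] (g : BilinField I M) (J : Fin 3 → EndField I M)
    (σ : Fin 3 → DForm I M 2) : Prop extends IsHyperHermitian g J σ where
  closed : ∀ i, (σ i).IsClosed

/-- The `2`-form `γ` is a section of `𝔰𝔭(n)`: it is of type `(1,1)` for every almost complex
structure `a J₀ + b J₁ + c J₂`, `a² + b² + c² = 1`, in the family spanned by `J`. A real `2`-form
is of type `(1,1)` for an almost complex structure if and only if it is invariant under it. -/
def IsSpForm (J : Fin 3 → EndField I M) (γ : DForm I M 2) : Prop :=
  ∀ a b c : ℝ, a ^ 2 + b ^ 2 + c ^ 2 = 1 → ∀ x (u v : TangentSpace I x),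
    γ x ![a • J 0 x u + b • J 1 x u + c • J 2 x u, a • J 0 x v + b • J 1 x v + c • J 2 x v]
      = γ x ![u, v]

end HyperHermitian

section Bundle

/-- The torus `𝕋⁴`, as a Lie group. -/
abbrev Torus4 : Type := Circle × Circle × Circle × Circle

/-- The model with corners of the torus. -/
abbrev torusModel := (𝓡 1).prod ((𝓡 1).prod ((𝓡 1).prod (𝓡 1)))

/-- The exponential map of the torus; its kernel is `(2πℤ)⁴`. -/
def torusExp (s : Fin 4 → ℝ) : Torus4 :=
  (Circle.exp (s 0), Circle.exp (s 1), Circle.exp (s 2), Circle.exp (s 3))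

variable {E : Type*} [NormedAddCommGroup E] [NormedSpace ℝ E]
  {H : Type*} [TopologicalSpace H] (I : ModelWithCorners ℝ E H)
  {M : Type*} [TopologicalSpace M] [ChartedSpace H M]
  {E' : Type*} [NormedAddCommGroup E'] [NormedSpace ℝ E']
  {H' : Type*} [TopologicalSpace H'] (I' : ModelWithCorners ℝ E' H')
  {P : Type*} [TopologicalSpace P] [ChartedSpace H' P]

/-- `pr : P → M`, with the given action of `𝕋⁴` on `P`, is a smooth principal `𝕋⁴`-bundle. -/
structure IsPrincipalTorusBundle [MulAction Torus4 P] (pr : P → M) : Prop where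
  smooth_proj : ContMDiff I' I ∞ pr
  smooth_action : ContMDiff (torusModel.prod I') I' ∞ (fun q : Torus4 × P => q.1 • q.2)
  proj_smul : ∀ (t : Torus4) (p : P), pr (t • p) = pr p
  locally_trivial : ∀ x : M, ∃ U : Set M, IsOpen U ∧ x ∈ U ∧
    ∃ Φ : PartialDiffeomorph I' (I.prod torusModel) P (M × Torus4) ∞,
      Φ.source = pr ⁻¹' U ∧ Φ.target = U ×ˢ Set.univ ∧
      (∀ p ∈ pr ⁻¹' U, (Φ p).1 = pr p) ∧
      ∀ p ∈ pr ⁻¹' U, ∀ t : Torus4, (Φ (t • p)).2 = t * (Φ p).2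

/-- The orbit `s ↦ exp(s eⱼ) • p` of `p` under the `j`-th circle factor of `𝕋⁴`. Its velocity at
`s = 0`, a tangent vector at `orbit j p 0 = p`, is the value at `p` of the `j`-th fundamental
vector field of the action. -/
def orbit {P : Type*} [MulAction Torus4 P] (j : Fin 4) (p : P) (s : ℝ) : P :=
  torusExp (Pi.single j s) • p

@[simp] theorem orbit_zero {P : Type*} [MulAction Torus4 P] (j : Fin 4) (p : P) :
    orbit j p 0 = p := by
  have : torusExp (Pi.single j 0) = 1 := by simp [torusExp]
  rw [orbit, this, one_smul]

variable {I'} in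
/-- `ν 0, …, ν 3` are the components of a (principal) connection form on the principal
`𝕋⁴`-bundle `P`: they are smooth, invariant, and dual to the fundamental vector fields. -/
structure IsConnectionForm [MulAction Torus4 P] (ν : Fin 4 → OneForm I' P) : Prop where
  smooth : ∀ i, (ν i).toDForm.IsSmooth
  invariant : ∀ i (t : Torus4) (p : P) (v : TangentSpace I' p),
    ν i (t • p) (mfderiv I' I' (fun q : P => t • q) p v) = ν i p v
  normalized : ∀ i j (p : P),
    ν i (orbit j p 0) (mfderiv 𝓘(ℝ, ℝ) I' (orbit j p) 0 (1 : ℝ)) = if i = j then 1 else 0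

variable {I I'}

/-- The metric `pr^* g + ν₁² + ν₂² + ν₃² + ν₄²`. -/
def liftedMetric (pr : P → M) (g : BilinField I M) (ν : Fin 4 → OneForm I' P) :
    BilinField I' P := fun p =>
  (ContinuousLinearMap.precomp ℝ (mfderiv I' I pr p)).comp ((g (pr p)).comp (mfderiv I' I pr p))
    + ∑ i, (ν i p).smulRight (ν i p)

theorem liftedMetric_apply (pr : P → M) (g : BilinField I M) (ν : Fin 4 → OneForm I' P) (p : P)
    (u v : TangentSpace I' p) :
    liftedMetric pr g ν p u v =
      g (pr p) (mfderiv I' I pr p u) (mfderiv I' I pr p v) + ∑ i, ν i p u * ν i p v := by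
  simp [liftedMetric]

/-- The triple of `2`-forms `pr^* σ₁ + ν₁ ∧ ν₂ + ν₃ ∧ ν₄`, `pr^* σ₂ + ν₁ ∧ ν₃ + ν₄ ∧ ν₂`,
`pr^* σ₃ + ν₁ ∧ ν₄ + ν₂ ∧ ν₃`; indices start at zero. -/
def liftedForms (pr : P → M) (σ : Fin 3 → DForm I M 2) (ν : Fin 4 → OneForm I' P) :
    Fin 3 → DForm I' P 2 :=
  ![(σ 0).pullback pr + (ν 0).wedge (ν 1) + (ν 2).wedge (ν 3),
    (σ 1).pullback pr + (ν 0).wedge (ν 2) + (ν 3).wedge (ν 1),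
    (σ 2).pullback pr + (ν 0).wedge (ν 3) + (ν 1).wedge (ν 2)]

end Bundle

end HKTorus

end

noncomputable section

namespace HKTorus

open VectorField Filter Topology Set

/-! ### Nijenhuis tensors and exterior derivatives on normed spaces -/

section Local

variable {V : Type*} [NormedAddCommGroup V] [NormedSpace ℝ V]
  {W : Type*} [NormedAddCommGroup W] [NormedSpace ℝ W]
  {F : Type*} [NormedAddCommGroup F] [NormedSpace ℝ F]

/-! At each point the pair (d`pr`, `ν`) identifies the tangent space of `P` with that of `M` times
`ℝ⁴`: it is onto, because `pr` has local sections and the fundamental fields are vertical and dual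
to `ν`, and the dimensions agree. The complex structures on `P` are the products of those on `M`
with left multiplication by the quaternion units on `ℝ⁴` (`IsLift`, `fiberJ`). Since (d`pr`, `ν`)
separates tangent vectors, the quaternion relations, orthogonality and the formula for the
fundamental forms reduce to identities on the two factors.

The substance is integrability. For a vector-valued 1-form `α` and an almost complex structure `J`,
Cartan's formula gives α(N(X, Y)) = dα(JX, JY) - dα(X, Y) - d(α∘J)(JX, Y) - d(α∘J)(X, JY)
(`apply_nijenhuis`). It is enough to test N on d`pr` and on `ν`. In charts the first is exact, and
the remaining terms are those of the Nijenhuis tensor of the base, pulled back. For the second, `ν`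
intertwines the structure with a constant endomorphism of `ℝ⁴`, so only curvature terms appear; they
cancel because the curvature is of type (1,1) for each of the three structures. This is
`nijenhuis_eq_zero`; the other parts transfer it to manifolds through the preferred charts. -/

/-- The exterior derivative of a vector-valued `1`-form on a normed space. -/
def curl (α : V → V →L[ℝ] F) (x u v : V) : F := fderiv ℝ α x u v - fderiv ℝ α x v u

/-- The expression `[X, Y] + J([J X, Y] + [X, J Y]) - [J X, J Y]` on a normed space. -/
def nijenhuis (J : V → V →L[ℝ] V) (X Y : V → V) (x : V) : V :=
  lieBracket ℝ X Y x + J x (lieBracket ℝ (fun y => J y (X y)) Y x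
    + lieBracket ℝ X (fun y => J y (Y y)) x)
    - lieBracket ℝ (fun y => J y (X y)) (fun y => J y (Y y)) x

/-- Cartan's formula for dα, solved for the bracket term. -/
theorem apply_lieBracket {α : V → V →L[ℝ] F} {X Y : V → V} {x : V}
    (hα : DifferentiableAt ℝ α x) (hX : DifferentiableAt ℝ X x) (hY : DifferentiableAt ℝ Y x) :
    α x (lieBracket ℝ X Y x) = fderiv ℝ (fun y => α y (Y y)) x (X x)
      - fderiv ℝ (fun y => α y (X y)) x (Y x) - curl α x (X x) (Y x) := by
  rw [fderiv_clm_apply hα hX, fderiv_clm_apply hα hY]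
  simp [lieBracket, curl]
  abel

/-- Cartan's formula is applied to each of the four brackets, with `α ∘ J` in place of `α` where the
bracket stands under `J`. As J² = -1, all derivatives of functions cancel and only the tensorial
terms survive. -/
theorem apply_nijenhuis {α : V → V →L[ℝ] F} {J : V → V →L[ℝ] V} {X Y : V → V} {x : V}
    (hα : DifferentiableAt ℝ α x) (hJ : DifferentiableAt ℝ J x)
    (hJJ : ∀ᶠ y in 𝓝 x, ∀ v, J y (J y v) = -v)
    (hX : DifferentiableAt ℝ X x) (hY : DifferentiableAt ℝ Y x) :
    α x (nijenhuis J X Y x) = curl α x (J x (X x)) (J x (Y x)) - curl α x (X x) (Y x)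
      - curl (fun y => (α y).comp (J y)) x (J x (X x)) (Y x)
      - curl (fun y => (α y).comp (J y)) x (X x) (J x (Y x)) := by
  have hJX : DifferentiableAt ℝ (fun y => J y (X y)) x := hJ.clm_apply hX
  have hJY : DifferentiableAt ℝ (fun y => J y (Y y)) x := hJ.clm_apply hY
  have hβ : DifferentiableAt ℝ (fun y => (α y).comp (J y)) x := hα.clm_comp hJ
  have key : ∀ Z : V → V, fderiv ℝ (fun y => ((α y).comp (J y)) (J y (Z y))) x
      = -fderiv ℝ (fun y => α y (Z y)) x := fun Z => by
    rw [← fderiv_fun_neg]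
    refine EventuallyEq.fderiv_eq ?_
    filter_upwards [hJJ] with y hy
    simp [hy]
  have e1 := apply_lieBracket hα hX hY
  have e2 := apply_lieBracket hβ hJX hY
  have e3 := apply_lieBracket hβ hX hJY
  have e4 := apply_lieBracket hα hJX hJY
  rw [key] at e2 e3
  simp only [ContinuousLinearMap.comp_apply, neg_apply] at e2 e3
  simp only [nijenhuis, map_add, map_sub, e1, e2, e3, e4]
  abel

theorem curl_id (x u v : V) : curl (fun _ => ContinuousLinearMap.id ℝ V) x u v = 0 := by
  simp [curl]

theorem curl_fderiv {f : V → F} {x : V} (hf : ContDiffAt ℝ 2 f x) (u v : V) :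
    curl (fderiv ℝ f) x u v = 0 := by
  rw [curl, sub_eq_zero]
  exact (hf.isSymmSndFDerivAt (by simp)) u v

theorem curl_congr {α β : V → V →L[ℝ] F} {x : V} (h : α =ᶠ[𝓝 x] β) (u v : V) :
    curl α x u v = curl β x u v := by
  simp only [curl, h.fderiv_eq]

theorem curl_const_comp (A : F →L[ℝ] W) {α : V → V →L[ℝ] F} {x : V}
    (hα : DifferentiableAt ℝ α x) (u v : V) :
    curl (fun y => A.comp (α y)) x u v = A (curl α x u v) := by
  have : HasFDerivAt (fun y => A.comp (α y)) _ x :=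
    ((ContinuousLinearMap.compL ℝ V F W A).hasFDerivAt).comp x hα.hasFDerivAt
  simp [curl, this.fderiv]

/-- `d(K ∘ df)` for an endomorphism-valued function `K` on the target of `f`. -/
theorem curl_comp_fderiv {f : V → F} {K : F → F →L[ℝ] F} {x : V} (hf : ContDiffAt ℝ 2 f x)
    (hK : DifferentiableAt ℝ K (f x)) (u v : V) :
    curl (fun y => (K (f y)).comp (fderiv ℝ f y)) x u v
      = curl K (f x) (fderiv ℝ f x u) (fderiv ℝ f x v) := by
  have hdf : DifferentiableAt ℝ (fderiv ℝ f) x :=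
    (hf.fderiv_right (m := 1) (by norm_num)).differentiableAt (by simp)
  have hf1 : DifferentiableAt ℝ f x := hf.differentiableAt (by simp)
  have hKf : HasFDerivAt (fun y => K (f y)) ((fderiv ℝ K (f x)).comp (fderiv ℝ f x)) x :=
    hK.hasFDerivAt.comp x hf1.hasFDerivAt
  have h := hKf.clm_comp hdf.hasFDerivAt
  -- Symmetry of the second derivative removes the term K(d²f), leaving the pull-back of dK.
  have hs : fderiv ℝ (fderiv ℝ f) x u v = fderiv ℝ (fderiv ℝ f) x v u :=
    (hf.isSymmSndFDerivAt (by simp)) u v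
  simp only [curl, h.fderiv]
  simp [hs]

/-- The vanishing of the Nijenhuis expression on constant vector fields, in terms of `dJ`. -/
theorem curl_of_nijenhuis_const_eq_zero {J : V → V →L[ℝ] V} {x : V}
    (hJ : DifferentiableAt ℝ J x) (hJJ : ∀ᶠ y in 𝓝 x, ∀ v, J y (J y v) = -v) {u v : V}
    (h : nijenhuis J (fun _ => u) (fun _ => v) x = 0) :
    curl J x (J x u) v + curl J x u (J x v) = 0 := by
  -- The identity is a closed vector-valued 1-form, and its composite with `J` is `J` itself, so the
  -- formula leaves only the two dJ terms.
  have := apply_nijenhuis (α := fun _ => ContinuousLinearMap.id ℝ V)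
    (differentiableAt_const _) hJ hJJ (differentiableAt_const u) (differentiableAt_const v)
  simp only [h, curl_id, map_zero, ContinuousLinearMap.id_comp] at this
  rw [← neg_eq_zero, neg_add]
  simpa [sub_eq_add_neg] using this.symm

/-- Integrability of an almost complex structure `J'` on the total space of a fibration `f`, from
that of the structure `J` on the base: `α` is a connection form, `j` the complex structure of the
fibre, and the curvature `dα` is of type `(1,1)`. -/
theorem nijenhuis_eq_zero {f : V → F} {J : F → F →L[ℝ] F} {α : V → V →L[ℝ] W}
    {J' : V → V →L[ℝ] V} (j : W →L[ℝ] W) {x : V} (hf : ContDiffAt ℝ 2 f x)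
    (hJ : DifferentiableAt ℝ J (f x)) (hα : DifferentiableAt ℝ α x)
    (hJ' : DifferentiableAt ℝ J' x)
    (hJJ : ∀ᶠ y in 𝓝 (f x), ∀ v, J y (J y v) = -v)
    (hJJ' : ∀ᶠ y in 𝓝 x, ∀ v, J' y (J' y v) = -v)
    (hfJ : ∀ᶠ y in 𝓝 x, (fderiv ℝ f y).comp (J' y) = (J (f y)).comp (fderiv ℝ f y))
    (hαJ : ∀ᶠ y in 𝓝 x, (α y).comp (J' y) = j.comp (α y))
    (hN : ∀ u v, nijenhuis J (fun _ => u) (fun _ => v) (f x) = 0)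
    (hcurv : ∀ u v, curl α x (J' x u) (J' x v) = curl α x u v)
    (hinj : ∀ v, fderiv ℝ f x v = 0 → α x v = 0 → v = 0)
    {X Y : V → V} (hX : DifferentiableAt ℝ X x) (hY : DifferentiableAt ℝ Y x) :
    nijenhuis J' X Y x = 0 := by
  have hdf : DifferentiableAt ℝ (fderiv ℝ f) x :=
    (hf.fderiv_right (m := 1) (by norm_num)).differentiableAt (by simp)
  refine hinj _ ?_ ?_
  · rw [apply_nijenhuis hdf hJ' hJJ' hX hY, curl_fderiv hf, curl_fderiv hf, curl_congr hfJ,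
      curl_congr hfJ, curl_comp_fderiv hf hJ, curl_comp_fderiv hf hJ]
    have e : ∀ v, fderiv ℝ f x (J' x v) = J (f x) (fderiv ℝ f x v) := fun v =>
      DFunLike.congr_fun hfJ.self_of_nhds v
    have := curl_of_nijenhuis_const_eq_zero hJ hJJ (hN (fderiv ℝ f x (X x)) (fderiv ℝ f x (Y x)))
    rw [e, e, sub_zero, zero_sub, sub_eq_add_neg, ← neg_add, this, neg_zero]
  -- By type (1,1), dα(J'X, Y) = dα(J'J'X, J'Y) = -dα(X, J'Y), so the two terms under `j` cancel.
  · rw [apply_nijenhuis hα hJ' hJJ' hX hY, curl_congr hαJ, curl_congr hαJ,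
      curl_const_comp j hα, curl_const_comp j hα, hcurv, sub_self, zero_sub, sub_eq_add_neg,
      ← neg_add, ← map_add, ← hcurv (J' x (X x)), hJJ'.self_of_nhds]
    simp [curl]

end Local

/-! ### Expressions of tensor fields in the preferred charts -/

section Charts

variable {E : Type*} [NormedAddCommGroup E] [NormedSpace ℝ E]
  {H : Type*} [TopologicalSpace H] (I : ModelWithCorners ℝ E H) [I.Boundaryless]
  {M : Type*} [TopologicalSpace M] [ChartedSpace H M] [IsManifold I ∞ M]

/-- The derivative at `x` of the preferred chart at `x₀`. -/
def chartD (x₀ x : M) : TangentSpace I x →L[ℝ] E := mfderiv I 𝓘(ℝ, E) (extChartAt I x₀) x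

/-- The derivative at `y` of the inverse of the preferred chart at `x₀`. -/
def chartDSymm (x₀ : M) (y : E) : E →L[ℝ] TangentSpace I ((extChartAt I x₀).symm y) :=
  mfderiv 𝓘(ℝ, E) I (extChartAt I x₀).symm y

variable {I}

omit [IsManifold I ∞ M] in
theorem mfderivWithin_range_eq_chartDSymm (x₀ : M) (y : E) :
    mfderivWithin 𝓘(ℝ, E) I (extChartAt I x₀).symm (range I) y = chartDSymm I x₀ y := by
  rw [I.range_eq_univ, mfderivWithin_univ, chartDSymm]

theorem chartD_chartDSymm {x₀ : M} {y : E} (hy : y ∈ (extChartAt I x₀).target) (v : E) :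
    chartD I x₀ ((extChartAt I x₀).symm y) (chartDSymm I x₀ y v) = v := by
  have : IsManifold I 1 M := IsManifold.of_le (n := ∞) (by norm_num)
  have := mfderiv_extChartAt_comp_mfderivWithin_extChartAt_symm hy
  rw [mfderivWithin_range_eq_chartDSymm] at this
  exact DFunLike.congr_fun this v

theorem chartDSymm_chartD {x₀ : M} {y : E} (hy : y ∈ (extChartAt I x₀).target)
    (v : TangentSpace I ((extChartAt I x₀).symm y)) :
    chartDSymm I x₀ y (chartD I x₀ ((extChartAt I x₀).symm y) v) = v := by
  have : IsManifold I 1 M := IsManifold.of_le (n := ∞) (by norm_num)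
  have := mfderivWithin_extChartAt_symm_comp_mfderiv_extChartAt hy
  rw [mfderivWithin_range_eq_chartDSymm] at this
  exact DFunLike.congr_fun this v

/-- Pull-backs of vector fields are defined through `inverse`; this identifies it with the
derivative of the chart. -/
theorem chartD_inverse {x₀ : M} {y : E} (hy : y ∈ (extChartAt I x₀).target)
    (v : TangentSpace I ((extChartAt I x₀).symm y)) :
    (mfderivWithin 𝓘(ℝ, E) I (extChartAt I x₀).symm (range I) y).inverse v
      = chartD I x₀ ((extChartAt I x₀).symm y) v := by
  rw [mfderivWithin_range_eq_chartDSymm]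
  have h : ∀ w, (chartDSymm I x₀ y).inverse w = chartD I x₀ ((extChartAt I x₀).symm y) w := by
    intro w
    rw [ContinuousLinearMap.inverse_eq (g := chartD I x₀ ((extChartAt I x₀).symm y))]
    · ext v; exact chartDSymm_chartD hy v
    · ext v; exact chartD_chartDSymm hy v
  exact h v

omit [I.Boundaryless] in
theorem chartD_self (x₀ : M) (v : TangentSpace I x₀) : chartD I x₀ x₀ v = v := by
  have : IsManifold I 1 M := IsManifold.of_le (n := ∞) (by norm_num)
  exact DFunLike.congr_fun (mfderiv_extChartAt_self (I := I) (x := x₀)) v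

/-- The expression of a vector field in the preferred chart at `x₀`. -/
def vectorInChart (X : (x : M) → TangentSpace I x) (x₀ : M) (y : E) : E :=
  chartD I x₀ ((extChartAt I x₀).symm y) (X ((extChartAt I x₀).symm y))

/-- The expression of a field of endomorphisms in the preferred chart at `x₀`. -/
def EndField.inChart (J : EndField I M) (x₀ : M) (y : E) : E →L[ℝ] E :=
  (chartD I x₀ ((extChartAt I x₀).symm y)).comp
    ((J ((extChartAt I x₀).symm y)).comp (chartDSymm I x₀ y))

/-- The expression of a field of bilinear forms in the preferred chart at `x₀`. -/
def BilinField.inChart (g : BilinField I M) (x₀ : M) (y : E) : E →L[ℝ] E →L[ℝ] ℝ :=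
  (ContinuousLinearMap.precomp ℝ (chartDSymm I x₀ y)).comp
    ((g ((extChartAt I x₀).symm y)).comp (chartDSymm I x₀ y))

/-- The expression of a `1`-form in the preferred chart at `x₀`. -/
def OneForm.inChart (ν : OneForm I M) (x₀ : M) (y : E) : E →L[ℝ] ℝ :=
  (ν ((extChartAt I x₀).symm y)).comp (chartDSymm I x₀ y)

theorem mpullbackWithin_eq_vectorInChart (X : (x : M) → TangentSpace I x) (x₀ : M) :
    mpullbackWithin 𝓘(ℝ, E) I (extChartAt I x₀).symm X (range I)
      =ᶠ[𝓝 (extChartAt I x₀ x₀)] vectorInChart X x₀ := by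
  filter_upwards [extChartAt_target_mem_nhds (I := I) x₀] with y hy
  exact chartD_inverse hy _

/-- The bracket on a manifold is defined by pulling both fields back to the model space; the
derivative of the chart undoes the final transport to `M`. -/
theorem chartD_mlieBracket (X Y : (x : M) → TangentSpace I x) (x₀ : M) :
    chartD I x₀ x₀ (mlieBracket I X Y x₀)
      = lieBracket ℝ (vectorInChart X x₀) (vectorInChart Y x₀) (extChartAt I x₀ x₀) := by
  have : IsManifold I 1 M := IsManifold.of_le (n := ∞) (by norm_num)
  rw [← (mpullbackWithin_eq_vectorInChart X x₀).lieBracket_vectorField_eq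
    (mpullbackWithin_eq_vectorInChart Y x₀), ← mlieBracketWithin_univ, mlieBracketWithin_apply]
  have hs : (extChartAt I x₀).symm ⁻¹' univ ∩ range I = univ := by simp [I.range_eq_univ]
  rw [hs]
  exact ((isInvertible_mfderiv_extChartAt (mem_extChartAt_source (I := I) x₀)).self_apply_inverse
    _).trans (congrFun (lieBracketWithin_univ (E := E)) (extChartAt I x₀ x₀))

theorem chartD_apply_endField (J : EndField I M) {x₀ x : M} (hx : x ∈ (extChartAt I x₀).source)
    (v : TangentSpace I x) :
    chartD I x₀ x (J x v) = J.inChart x₀ (extChartAt I x₀ x) (chartD I x₀ x v) := by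
  -- Writing the point as an image of the inverse chart makes the types match: `chartDSymm` takes
  -- values in the tangent space at such a point.
  obtain ⟨y, hy, rfl⟩ : ∃ y ∈ (extChartAt I x₀).target, (extChartAt I x₀).symm y = x :=
    ⟨_, (extChartAt I x₀).map_source hx, (extChartAt I x₀).left_inv hx⟩
  rw [(extChartAt I x₀).right_inv hy]
  simp only [EndField.inChart, ContinuousLinearMap.comp_apply]
  rw [chartDSymm_chartD hy]

theorem vectorInChart_apply_endField (J : EndField I M) (X : (x : M) → TangentSpace I x) {x₀ : M}
    {y : E} (hy : y ∈ (extChartAt I x₀).target) :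
    vectorInChart (fun x => J x (X x)) x₀ y = J.inChart x₀ y (vectorInChart X x₀ y) := by
  simp only [vectorInChart, EndField.inChart, ContinuousLinearMap.comp_apply]
  rw [chartDSymm_chartD hy]

/-- The Nijenhuis tensor at the centre of a chart can be computed in the chart. -/
theorem chartD_nijenhuis (J : EndField I M) (X Y : (x : M) → TangentSpace I x) (x₀ : M) :
    chartD I x₀ x₀ (mlieBracket I X Y x₀
      + J x₀ (mlieBracket I (fun y => J y (X y)) Y x₀ + mlieBracket I X (fun y => J y (Y y)) x₀)
      - mlieBracket I (fun y => J y (X y)) (fun y => J y (Y y)) x₀)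
    = nijenhuis (J.inChart x₀) (vectorInChart X x₀) (vectorInChart Y x₀)
        (extChartAt I x₀ x₀) := by
  have h : ∀ Z : (x : M) → TangentSpace I x, vectorInChart (fun x => J x (Z x)) x₀
      =ᶠ[𝓝 (extChartAt I x₀ x₀)] fun y => J.inChart x₀ y (vectorInChart Z x₀ y) := fun Z => by
    filter_upwards [extChartAt_target_mem_nhds (I := I) x₀] with y hy
    exact vectorInChart_apply_endField J Z hy
  rw [map_sub, map_add, chartD_apply_endField J (mem_extChartAt_source x₀), map_add,
    chartD_mlieBracket, chartD_mlieBracket, chartD_mlieBracket, chartD_mlieBracket,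
    (h X).lieBracket_vectorField_eq (EventuallyEq.refl _ _),
    (EventuallyEq.refl _ _).lieBracket_vectorField_eq (h Y),
    (h X).lieBracket_vectorField_eq (h Y), nijenhuis]

theorem differentiableAt_vectorInChart [CompleteSpace E] {X : (x : M) → TangentSpace I x} {x₀ : M}
    (hX : ContMDiffAt I I.tangent ∞ (fun y => (⟨y, X y⟩ : TangentBundle I M)) x₀) :
    DifferentiableAt ℝ (vectorInChart X x₀) (extChartAt I x₀ x₀) := by
  have : IsManifold I 1 M := IsManifold.of_le (n := ∞) (by norm_num)
  have : IsManifold I 2 M := IsManifold.of_le (n := ∞) (WithTop.coe_le_coe.2 (le_top : (2 : ℕ∞) ≤ ⊤))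
  have h := (hX.mdifferentiableAt (by simp)).mdifferentiableWithinAt (s := univ)
  have := h.differentiableWithinAt_mpullbackWithin_vectorField
  have hs : (extChartAt I x₀).symm ⁻¹' univ ∩ range I = univ := by simp [I.range_eq_univ]
  rw [hs] at this
  exact (differentiableWithinAt_univ.1 this).congr_of_eventuallyEq (mpullbackWithin_eq_vectorInChart X x₀).symm

variable (I) in
/-- The vector field that is constant, with value `u`, in the preferred chart at `x₀`. -/
def constInChart (x₀ : M) (u : E) (x : M) : TangentSpace I x :=
  mpullback I 𝓘(ℝ, E) (extChartAt I x₀) (fun _ => u) x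

omit [I.Boundaryless] in
theorem contMDiffAt_constInChart [CompleteSpace E] (x₀ : M) (u : E) :
    ContMDiffAt I I.tangent ∞ (fun y => (⟨y, constInChart I x₀ u y⟩ : TangentBundle I M)) x₀ := by
  have : IsManifold I 1 M := IsManifold.of_le (n := ∞) (by norm_num)
  refine ContMDiffAt.mpullback_vectorField_preimage (n := ∞) (V := fun _ : E => u) ?_
    contMDiffAt_extChartAt (isInvertible_mfderiv_extChartAt (mem_extChartAt_source x₀))
    (by norm_num)
  exact contMDiffAt_vectorSpace_iff_contDiffAt.2 contDiffAt_const

theorem vectorInChart_constInChart {x₀ : M} (u : E) :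
    vectorInChart (constInChart I x₀ u) x₀ =ᶠ[𝓝 (extChartAt I x₀ x₀)] fun _ => u := by
  have : IsManifold I 1 M := IsManifold.of_le (n := ∞) (by norm_num)
  filter_upwards [extChartAt_target_mem_nhds (I := I) x₀] with y hy
  exact (isInvertible_mfderiv_extChartAt ((extChartAt I x₀).map_target hy)).self_apply_inverse _

theorem nijenhuis_congr {V : Type*} [NormedAddCommGroup V] [NormedSpace ℝ V] (J : V → V →L[ℝ] V)
    {X X' Y Y' : V → V} {x : V} (hX : X =ᶠ[𝓝 x] X') (hY : Y =ᶠ[𝓝 x] Y') :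
    nijenhuis J X Y x = nijenhuis J X' Y' x := by
  have h : ∀ {Z Z' : V → V}, Z =ᶠ[𝓝 x] Z' →
      (fun y => J y (Z y)) =ᶠ[𝓝 x] fun y => J y (Z' y) := fun h => by
    filter_upwards [h] with y hy using by rw [hy]
  rw [nijenhuis, nijenhuis, hX.lieBracket_vectorField_eq hY,
    (h hX).lieBracket_vectorField_eq hY, hX.lieBracket_vectorField_eq (h hY),
    (h hX).lieBracket_vectorField_eq (h hY)]

/-- Integrability is tested on fields that are constant in the chart; these are smooth at the
centre. -/
theorem EndField.IsIntegrable.nijenhuis_inChart [CompleteSpace E] {J : EndField I M}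
    (hJ : J.IsIntegrable) (x₀ : M) (u v : E) :
    nijenhuis (J.inChart x₀) (fun _ => u) (fun _ => v) (extChartAt I x₀ x₀) = 0 := by
  rw [← nijenhuis_congr _ (vectorInChart_constInChart u) (vectorInChart_constInChart v),
    ← chartD_nijenhuis, hJ x₀ _ _ (contMDiffAt_constInChart x₀ u) (contMDiffAt_constInChart x₀ v),
    map_zero]

/-- Every point is the centre of its own preferred chart, where the chart has derivative the
identity. Only first derivatives of the fields enter, so differentiability of their expressions
suffices. -/
theorem EndField.isIntegrable_of_inChart [CompleteSpace E] {J : EndField I M}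
    (h : ∀ (x₀ : M) (X Y : E → E), DifferentiableAt ℝ X (extChartAt I x₀ x₀) →
      DifferentiableAt ℝ Y (extChartAt I x₀ x₀) →
      nijenhuis (J.inChart x₀) X Y (extChartAt I x₀ x₀) = 0) : J.IsIntegrable := by
  intro x X Y hX hY
  rw [← chartD_self x (_ - _), chartD_nijenhuis]
  exact h x _ _ (differentiableAt_vectorInChart hX) (differentiableAt_vectorInChart hY)

omit [IsManifold I ∞ M] in
theorem contMDiffAt_comp_extChartAt_iff {F : Type*} [NormedAddCommGroup F] [NormedSpace ℝ F]
    (f : E → F) (x₀ : M) :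
    ContMDiffAt I 𝓘(ℝ, F) ∞ (fun x => f (extChartAt I x₀ x)) x₀
      ↔ ContDiffAt ℝ ∞ f (extChartAt I x₀ x₀) := by
  rw [contMDiffAt_iff_source, I.range_eq_univ, contMDiffWithinAt_univ, contMDiffAt_iff_contDiffAt]
  have h : (fun x => f (extChartAt I x₀ x)) ∘ (extChartAt I x₀).symm
      =ᶠ[𝓝 (extChartAt I x₀ x₀)] f := by
    filter_upwards [extChartAt_target_mem_nhds (I := I) x₀] with y hy
    rw [Function.comp_apply, (extChartAt I x₀).right_inv hy]
  exact ⟨fun hf => hf.congr_of_eventuallyEq h.symm, fun hf => hf.congr_of_eventuallyEq h⟩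

omit [I.Boundaryless] in
theorem chartD_symm_trivializationAt {x₀ x : M} (hx : x ∈ (extChartAt I x₀).source) (v : E) :
    chartD I x₀ x ((trivializationAt E (TangentSpace I) x₀).symm x v) = v := by
  have : IsManifold I 1 M := IsManifold.of_le (n := ∞) (by norm_num)
  rw [extChartAt_source] at hx
  have h := DFunLike.congr_fun (TangentBundle.continuousLinearMapAt_trivializationAt (I := I) hx)
    ((trivializationAt E (TangentSpace I) x₀).symm x v)
  refine h.symm.trans ?_
  rw [← Bundle.Trivialization.symmL_apply (R := ℝ) _ (by simpa using hx)]
  exact (trivializationAt E (TangentSpace I) x₀).continuousLinearMapAt_symmL (R := ℝ)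
    (by simpa using hx) v

theorem bilinField_apply_eq (g : BilinField I M) {x₀ x : M} (hx : x ∈ (extChartAt I x₀).source)
    (u v : TangentSpace I x) :
    g x u v = g.inChart x₀ (extChartAt I x₀ x) (chartD I x₀ x u) (chartD I x₀ x v) := by
  obtain ⟨y, hy, rfl⟩ : ∃ y ∈ (extChartAt I x₀).target, (extChartAt I x₀).symm y = x :=
    ⟨_, (extChartAt I x₀).map_source hx, (extChartAt I x₀).left_inv hx⟩
  rw [(extChartAt I x₀).right_inv hy]
  change _ = g _ (chartDSymm I x₀ y _) (chartDSymm I x₀ y _)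
  rw [chartDSymm_chartD hy, chartDSymm_chartD hy]

/-- The trivialization of the tangent bundle at `x₀` is the derivative of the chart at `x₀`, so
bundle coordinates and chart expressions agree near `x₀`. Smoothness of sections thereby becomes
smoothness on the model space. -/
theorem EndField.inCoordinates_eventuallyEq (J : EndField I M) (x₀ : M) :
    (fun x => ContinuousLinearMap.inCoordinates E (TangentSpace I) E (TangentSpace I)
      x₀ x x₀ x (J x)) =ᶠ[𝓝 x₀] fun x => J.inChart x₀ (extChartAt I x₀ x) := by
  have : IsManifold I 1 M := IsManifold.of_le (n := ∞) (by norm_num)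
  filter_upwards [extChartAt_source_mem_nhds (I := I) x₀] with x hx
  ext v
  have hx' := hx
  rw [extChartAt_source] at hx'
  have h := chartD_apply_endField J hx ((trivializationAt E (TangentSpace I) x₀).symm x v)
  rw [chartD_symm_trivializationAt hx] at h
  rw [← h, ContinuousLinearMap.inCoordinates,
    TangentBundle.continuousLinearMapAt_trivializationAt (I := I) hx',
    ← Bundle.Trivialization.symmL_apply (R := ℝ) _ (by simpa using hx')]
  rfl

theorem BilinField.inCoordinates_eventuallyEq (g : BilinField I M) (x₀ : M) :
    (fun x => ContinuousLinearMap.inCoordinates E (TangentSpace I) (E →L[ℝ] ℝ)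
      (fun x : M => TangentSpace I x →L[ℝ] ℝ) x₀ x x₀ x (g x))
      =ᶠ[𝓝 x₀] fun x => g.inChart x₀ (extChartAt I x₀ x) := by
  have : IsManifold I 1 M := IsManifold.of_le (n := ∞) (by norm_num)
  filter_upwards [extChartAt_source_mem_nhds (I := I) x₀] with x hx
  ext u v
  have hx' := hx
  rw [extChartAt_source] at hx'
  have h := bilinField_apply_eq g hx ((trivializationAt E (TangentSpace I) x₀).symm x u)
    ((trivializationAt E (TangentSpace I) x₀).symm x v)
  rw [chartD_symm_trivializationAt hx, chartD_symm_trivializationAt hx] at h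
  rw [← h, inCoordinates_apply_eq₂ (by simpa using hx') (by simpa using hx') (by simp)]
  simp

theorem EndField.isSmooth_iff {J : EndField I M} :
    J.IsSmooth ↔ ∀ x₀, ContDiffAt ℝ ∞ (J.inChart x₀) (extChartAt I x₀ x₀) := by
  refine forall_congr' fun x₀ => ?_
  rw [contMDiffAt_hom_bundle, ← contMDiffAt_comp_extChartAt_iff]
  exact ⟨fun h => h.2.congr_of_eventuallyEq (EndField.inCoordinates_eventuallyEq _ x₀).symm,
    fun h => ⟨contMDiffAt_id, h.congr_of_eventuallyEq (EndField.inCoordinates_eventuallyEq _ x₀)⟩⟩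

theorem BilinField.contMDiff_iff {g : BilinField I M} :
    ContMDiff I (I.prod 𝓘(ℝ, E →L[ℝ] E →L[ℝ] ℝ)) ∞
      (fun x => Bundle.TotalSpace.mk' (E →L[ℝ] E →L[ℝ] ℝ)
        (E := fun x : M => TangentSpace I x →L[ℝ] TangentSpace I x →L[ℝ] ℝ) x (g x))
      ↔ ∀ x₀, ContDiffAt ℝ ∞ (g.inChart x₀) (extChartAt I x₀ x₀) := by
  refine forall_congr' fun x₀ => ?_
  rw [contMDiffAt_hom_bundle, ← contMDiffAt_comp_extChartAt_iff]
  exact ⟨fun h => h.2.congr_of_eventuallyEq (BilinField.inCoordinates_eventuallyEq _ x₀).symm,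
    fun h => ⟨contMDiffAt_id, h.congr_of_eventuallyEq (BilinField.inCoordinates_eventuallyEq _ x₀)⟩⟩

end Charts

/-! ### One-forms: covectors versus alternating forms -/

section OneForms

variable {E : Type*} [NormedAddCommGroup E] [NormedSpace ℝ E]
  {H : Type*} [TopologicalSpace H] {I : ModelWithCorners ℝ E H} [I.Boundaryless]
  {M : Type*} [TopologicalSpace M] [ChartedSpace H M]

variable (E) in
/-- Covectors and alternating forms of degree one are the same. -/
def covectorEquiv : (E →L[ℝ] ℝ) ≃L[ℝ] (E [⋀^Fin 1]→L[ℝ] ℝ) :=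
  (ContinuousAlternatingMap.ofSubsingletonLIE (0 : Fin 1)).toContinuousLinearEquiv

omit [I.Boundaryless] in
theorem OneForm.toDForm_inChart (ν : OneForm I M) (x₀ : M) :
    ν.toDForm.inChart x₀ = covectorEquiv E ∘ ν.inChart x₀ := by
  funext y
  ext v
  rfl

theorem OneForm.contDiffAt_inChart {ν : OneForm I M} (hν : ν.toDForm.IsSmooth) (x₀ : M) :
    ContDiffAt ℝ ∞ (ν.inChart x₀) (extChartAt I x₀ x₀) := by
  have h := (hν x₀).contDiffAt (extChartAt_target_mem_nhds x₀)
  rwa [OneForm.toDForm_inChart, ContinuousLinearEquiv.comp_contDiffAt_iff] at h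

-- In degree one `extDeriv` is the antisymmetrized derivative. `covectorEquiv` is a linear
-- equivalence and commutes with `fderiv` unconditionally, so no smoothness is needed.
omit [I.Boundaryless] in
theorem OneForm.curl_inChart (ν : OneForm I M) (x₀ : M) (u v : TangentSpace I x₀) :
    curl (ν.inChart x₀) (extChartAt I x₀ x₀) (chartD I x₀ x₀ u) (chartD I x₀ x₀ v)
      = ν.toDForm.d x₀ ![u, v] := by
  have key : ∀ a b : E, extDeriv (ν.toDForm.inChart x₀) (extChartAt I x₀ x₀) ![a, b]
      = curl (ν.inChart x₀) (extChartAt I x₀ x₀) a b := by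
    intro a b
    rw [extDeriv, OneForm.toDForm_inChart, ContinuousLinearEquiv.comp_fderiv,
      ContinuousAlternatingMap.alternatizeUncurryFin_apply, Fin.sum_univ_two]
    simp [curl, covectorEquiv, Fin.removeNth, sub_eq_add_neg]
  rw [← key]
  refine congrArg (extDeriv (ν.toDForm.inChart x₀) (extChartAt I x₀ x₀)) ?_
  funext i
  fin_cases i <;> rfl

omit [I.Boundaryless] in
theorem DForm.pullback_apply_two {E' : Type*} [NormedAddCommGroup E'] [NormedSpace ℝ E']
    {H' : Type*} [TopologicalSpace H'] {I' : ModelWithCorners ℝ E' H'}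
    {P : Type*} [TopologicalSpace P] [ChartedSpace H' P] (f : P → M) (η : DForm I M 2) (p : P)
    (u v : TangentSpace I' p) :
    η.pullback (I' := I') f p ![u, v] = η (f p) ![mfderiv I' I f p u, mfderiv I' I f p v] := by
  refine congrArg (η (f p)) ?_
  funext i
  fin_cases i <;> rfl

end OneForms

/-! ### Finite-dimensional linear algebra and the quaternions on ℝ⁴ -/

section LinearAlgebra

variable {V : Type*} [NormedAddCommGroup V] [NormedSpace ℝ V] [FiniteDimensional ℝ V]
  {W : Type*} [NormedAddCommGroup W] [NormedSpace ℝ W] [FiniteDimensional ℝ W]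

theorem isInvertible_of_injective (h : Module.finrank ℝ V = Module.finrank ℝ W) (A : V →L[ℝ] W)
    (hA : ∀ v, A v = 0 → v = 0) : A.IsInvertible := by
  have hi : Function.Injective (A : V →ₗ[ℝ] W) := (injective_iff_map_eq_zero _).2 hA
  exact ⟨(LinearEquiv.ofInjectiveOfFinrankEq (A : V →ₗ[ℝ] W) hi h).toContinuousLinearEquiv,
    by ext v; rfl⟩

/-- A positive minimum `m` of the quadratic form on the compact unit sphere bounds the norm on the
unit ball of `B` by √(1/m). Riemannian metrics on bundles carry this boundedness as a field. -/
theorem isVonNBounded_of_posDef (B : V →L[ℝ] V →L[ℝ] ℝ) (hB : ∀ v, v ≠ 0 → 0 < B v v) :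
    Bornology.IsVonNBounded ℝ {v | B v v < 1} := by
  rw [NormedSpace.isVonNBounded_iff']
  have hcont : Continuous fun v => B v v := by fun_prop
  obtain ⟨m, hm, hmB⟩ : ∃ m > 0, ∀ v : V, ‖v‖ = 1 → m ≤ B v v := by
    -- The sphere is empty when `V` is zero; any positive `m` then serves.
    rcases (Metric.sphere (0 : V) 1).eq_empty_or_nonempty with h | h
    · refine ⟨1, one_pos, fun v hv => ?_⟩
      have : v ∈ Metric.sphere (0 : V) 1 := by simpa using hv
      simp [h] at this
    · obtain ⟨w, hw, hmin⟩ := (isCompact_sphere (0 : V) 1).exists_isMinOn h hcont.continuousOn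
      refine ⟨B w w, hB w ?_, fun v hv => hmin (by simpa using hv)⟩
      rintro rfl
      simp at hw
  refine ⟨Real.sqrt m⁻¹, fun v hv => ?_⟩
  by_cases hv0 : v = 0
  · simp [hv0]
  have hn : 0 < ‖v‖ := norm_pos_iff.2 hv0
  have h1 := hmB (‖v‖⁻¹ • v) (by rw [norm_smul, norm_inv, norm_norm, inv_mul_cancel₀ hn.ne'])
  simp only [map_smul, smul_apply, smul_eq_mul] at h1
  have h2 : m * ‖v‖ ^ 2 ≤ B v v := by
    calc m * ‖v‖ ^ 2 ≤ (‖v‖⁻¹ * (‖v‖⁻¹ * B v v)) * ‖v‖ ^ 2 := by gcongr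
      _ = B v v := by field_simp
  refine Real.le_sqrt_of_sq_le ?_
  rw [← one_div, le_div_iff₀ hm]
  have : B v v < 1 := hv
  linarith

/-- The standard quaternionic structure of `ℝ⁴`, given by left multiplication with the imaginary
units. -/
def fiberJ : Fin 3 → ((Fin 4 → ℝ) →L[ℝ] (Fin 4 → ℝ)) :=
  let e : Fin 4 → ((Fin 4 → ℝ) →L[ℝ] ℝ) := fun i => ContinuousLinearMap.proj i
  ![ContinuousLinearMap.pi ![-e 1, e 0, -e 3, e 2],
    ContinuousLinearMap.pi ![-e 2, e 3, e 0, -e 1],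
    ContinuousLinearMap.pi ![-e 3, -e 2, e 1, e 0]]

theorem fiberJ_zero_apply (a : Fin 4 → ℝ) : fiberJ 0 a = ![-a 1, a 0, -a 3, a 2] := by
  funext k; fin_cases k <;> simp [fiberJ]

theorem fiberJ_one_apply (a : Fin 4 → ℝ) : fiberJ 1 a = ![-a 2, a 3, a 0, -a 1] := by
  funext k; fin_cases k <;> simp [fiberJ]

theorem fiberJ_two_apply (a : Fin 4 → ℝ) : fiberJ 2 a = ![-a 3, -a 2, a 1, a 0] := by
  funext k; fin_cases k <;> simp [fiberJ]

theorem fiberJ_sq (i : Fin 3) (a : Fin 4 → ℝ) : fiberJ i (fiberJ i a) = -a := by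
  funext k
  fin_cases i <;> fin_cases k <;>
    simp [fiberJ_zero_apply, fiberJ_one_apply, fiberJ_two_apply]

theorem fiberJ_mul (i : Fin 3) (a : Fin 4 → ℝ) :
    fiberJ i (fiberJ (i + 1) a) = fiberJ (i + 2) a := by
  have h1 : (2 : Fin 3) + 1 = 0 := rfl
  have h2 : (1 : Fin 3) + 2 = 0 := rfl
  have h3 : (2 : Fin 3) + 2 = 1 := rfl
  have h4 : (1 : Fin 3) + 1 = 2 := rfl
  funext k
  fin_cases i <;> fin_cases k <;>
    simp [fiberJ_zero_apply, fiberJ_one_apply, fiberJ_two_apply, h1, h2, h3, h4]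

theorem fiberJ_anticomm (i : Fin 3) (a : Fin 4 → ℝ) :
    fiberJ i (fiberJ (i + 1) a) = -fiberJ (i + 1) (fiberJ i a) := by
  have h1 : (2 : Fin 3) + 1 = 0 := rfl
  have h4 : (1 : Fin 3) + 1 = 2 := rfl
  funext k
  fin_cases i <;> fin_cases k <;>
    simp [fiberJ_zero_apply, fiberJ_one_apply, fiberJ_two_apply, h1, h4]

theorem fiberJ_orthogonal (i : Fin 3) (a b : Fin 4 → ℝ) :
    ∑ k, fiberJ i a k * fiberJ i b k = ∑ k, a k * b k := by
  fin_cases i <;>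
    simp [fiberJ_zero_apply, fiberJ_one_apply, fiberJ_two_apply, Fin.sum_univ_four] <;> ring

end LinearAlgebra

/-! ### Splitting of the tangent spaces of `P` -/

section TotalSpace

variable {E : Type*} [NormedAddCommGroup E] [NormedSpace ℝ E]
  {H : Type*} [TopologicalSpace H] {I : ModelWithCorners ℝ E H}
  {M : Type*} [TopologicalSpace M] [ChartedSpace H M]
  {E' : Type*} [NormedAddCommGroup E'] [NormedSpace ℝ E']
  {H' : Type*} [TopologicalSpace H'] {I' : ModelWithCorners ℝ E' H'}
  {P : Type*} [TopologicalSpace P] [ChartedSpace H' P]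

/-- The components of a family of four covectors, as one vector-valued covector. -/
def connectionVector (ν : Fin 4 → OneForm I' P) (p : P) :
    TangentSpace I' p →L[ℝ] (Fin 4 → ℝ) :=
  ContinuousLinearMap.pi fun i => ν i p

theorem exists_vertical [MulAction Torus4 P] {pr : P → M} (hpr : IsPrincipalTorusBundle I I' pr)
    {ν : Fin 4 → OneForm I' P} (hν : IsConnectionForm ν) (j : Fin 4) (p : P) :
    ∃ X : TangentSpace I' p, (∀ i, ν i p X = if i = j then 1 else 0) ∧
      mfderiv I' I pr p X = 0 := by
  have h : ∃ X : TangentSpace I' (orbit j p 0), (∀ i, ν i (orbit j p 0) X = if i = j then 1 else 0) ∧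
      mfderiv I' I pr (orbit j p 0) X = 0 := by
    refine ⟨mfderiv 𝓘(ℝ, ℝ) I' (orbit j p) 0 (1 : ℝ), fun i => hν.normalized i j p, ?_⟩
    -- Differentiability of the orbit follows from normalization: otherwise its `mfderiv` would be
    -- zero by default, yet `ν j` takes the value 1 on it.
    have hd : MDifferentiableAt 𝓘(ℝ, ℝ) I' (orbit j p) 0 := by
      by_contra hd
      have := hν.normalized j j p
      rw [mfderiv_zero_of_not_mdifferentiableAt hd, if_pos rfl] at this
      exact zero_ne_one ((map_zero (ν j (orbit j p 0))).symm.trans this)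
    have hprd : MDifferentiableAt I' I pr (orbit j p 0) :=
      hpr.smooth_proj.mdifferentiableAt (by simp)
    have hc := mfderiv_comp (0 : ℝ) hprd hd
    have hconst : pr ∘ orbit j p = fun _ => pr p := funext fun s => hpr.proj_smul _ _
    rw [hconst, mfderiv_const] at hc
    exact (DFunLike.congr_fun hc (1 : ℝ)).symm
  rwa [orbit_zero] at h

/-- A local trivialization gives a smooth local section through `p`, with the torus coordinate
frozen at that of `p`; its derivative is a right inverse. -/
theorem mfderiv_proj_surjective [MulAction Torus4 P] {pr : P → M}
    (hpr : IsPrincipalTorusBundle I I' pr) (p : P) :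
    Function.Surjective (mfderiv I' I pr p) := by
  obtain ⟨U, hU, hxU, Φ, hs, ht, hΦ, -⟩ := hpr.locally_trivial (pr p)
  have hp : p ∈ Φ.source := by rw [hs]; exact hxU
  have hΦp : Φ p = (pr p, (Φ p).2) := Prod.ext (hΦ p hxU) rfl
  set s : M → P := fun m => Φ.invFun (m, (Φ p).2) with hsdef
  have hmem : (pr p, (Φ p).2) ∈ Φ.target := by rw [ht]; exact ⟨hxU, mem_univ _⟩
  have hsp : s (pr p) = p := by
    rw [hsdef]
    change Φ.invFun (pr p, (Φ p).2) = p
    rw [← hΦp]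
    exact Φ.left_inv hp
  have hsd : MDifferentiableAt I I' s (pr p) := by
    have h1 : ContMDiffAt (I.prod torusModel) I' ∞ Φ.invFun (pr p, (Φ p).2) :=
      Φ.contMDiffOn_invFun.contMDiffAt (Φ.open_target.mem_nhds hmem)
    have h2 : ContMDiffAt I (I.prod torusModel) ∞ (fun m : M => (m, (Φ p).2)) (pr p) :=
      contMDiffAt_id.prodMk contMDiffAt_const
    exact (h1.comp (pr p) h2).mdifferentiableAt (by simp)
  have hprd : MDifferentiableAt I' I pr (s (pr p)) :=
    hpr.smooth_proj.mdifferentiableAt (by simp)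
  have hc := mfderiv_comp (pr p) hprd hsd
  have hid : pr ∘ s =ᶠ[𝓝 (pr p)] id := by
    filter_upwards [hU.mem_nhds hxU] with m hm
    have hm' : (m, (Φ p).2) ∈ Φ.target := by rw [ht]; exact ⟨hm, mem_univ _⟩
    have h3 : s m ∈ pr ⁻¹' U := hs ▸ Φ.map_target hm'
    have h4 := hΦ _ h3
    have h5 : Φ (s m) = (m, (Φ p).2) := Φ.right_inv hm'
    rw [h5] at h4
    exact h4.symm
  have hsurj : Function.Surjective (mfderiv I' I pr (s (pr p))) := by
    intro w
    refine ⟨mfderiv I I' s (pr p) w, ?_⟩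
    refine (DFunLike.congr_fun hc w).symm.trans ?_
    rw [hid.mfderiv_eq, mfderiv_id]
    rfl
  rwa [hsp] at hsurj

variable [FiniteDimensional ℝ E] [FiniteDimensional ℝ E']

/-- The map (d`pr`, `ν`) is surjective between spaces of equal dimension, hence injective. -/
theorem eq_zero_of_vertical_of_horizontal [MulAction Torus4 P] {pr : P → M}
    (hdim : Module.finrank ℝ E' = Module.finrank ℝ E + 4)
    (hpr : IsPrincipalTorusBundle I I' pr)
    {ν : Fin 4 → OneForm I' P} (hν : IsConnectionForm ν) (p : P) (v : TangentSpace I' p)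
    (h₁ : mfderiv I' I pr p v = 0) (h₂ : connectionVector ν p v = 0) : v = 0 := by
  have hd : Module.finrank ℝ E' = Module.finrank ℝ (E × (Fin 4 → ℝ)) := by
    rw [Module.finrank_prod, Module.finrank_fin_fun, hdim]
  let L : E' →ₗ[ℝ] E × (Fin 4 → ℝ) :=
    (((mfderiv I' I pr p).prod (connectionVector ν p) :
      TangentSpace I' p →L[ℝ] TangentSpace I (pr p) × (Fin 4 → ℝ)) :
      TangentSpace I' p →ₗ[ℝ] TangentSpace I (pr p) × (Fin 4 → ℝ))
  have hL : Function.Surjective L := by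
    choose X hX hX' using fun j => exists_vertical hpr hν j p
    rintro ⟨w, a⟩
    obtain ⟨v, hv⟩ := mfderiv_proj_surjective hpr p w
    -- The vertical correction adjusts the values of `ν` to `a` without changing the projection.
    refine ⟨v + ∑ j, (a j - ν j p v) • X j, Prod.ext ?_ ?_⟩
    · change mfderiv I' I pr p (v + ∑ j, (a j - ν j p v) • X j) = w
      simp only [map_add, map_sum, map_smul, hX', smul_zero, Finset.sum_const_zero, hv]
      exact add_zero w
    · change connectionVector ν p (v + ∑ j, (a j - ν j p v) • X j) = a
      funext i
      simp [connectionVector, hX]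
  have hinj := (LinearMap.injective_iff_surjective_of_finrank_eq_finrank hd).2 hL
  exact hinj (a₁ := v) (a₂ := (0 : E')) ((Prod.ext h₁ h₂ : L v = 0).trans (map_zero L).symm)

end TotalSpace

/-! ### Lifting complex structures: existence, smoothness, integrability -/

section Lift

variable {E : Type*} [NormedAddCommGroup E] [NormedSpace ℝ E]
  {H : Type*} [TopologicalSpace H] {I : ModelWithCorners ℝ E H}
  {M : Type*} [TopologicalSpace M] [ChartedSpace H M]
  {E' : Type*} [NormedAddCommGroup E'] [NormedSpace ℝ E']
  {H' : Type*} [TopologicalSpace H'] {I' : ModelWithCorners ℝ E' H'}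
  {P : Type*} [TopologicalSpace P] [ChartedSpace H' P]

/-- `J'` is the lift of `J` to the total space `P`: it covers `J`, and it acts by `j` on the
components of the connection form. -/
structure IsLift (pr : P → M) (ν : Fin 4 → OneForm I' P) (J : EndField I M)
    (j : (Fin 4 → ℝ) →L[ℝ] (Fin 4 → ℝ)) (J' : EndField I' P) : Prop where
  proj : ∀ p (v : TangentSpace I' p),
    mfderiv I' I pr p (J' p v) = J (pr p) (mfderiv I' I pr p v)
  conn : ∀ p (v : TangentSpace I' p),
    connectionVector ν p (J' p v) = j (connectionVector ν p v)

/-- The derivative of `pr` and the forms `ν` together separate tangent vectors. -/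
def IsSeparating (I : ModelWithCorners ℝ E H) (pr : P → M)
    (ν : Fin 4 → OneForm I' P) : Prop :=
  ∀ p (v : TangentSpace I' p), mfderiv I' I pr p v = 0 → connectionVector ν p v = 0 → v = 0

theorem IsSeparating.ext {pr : P → M} {ν : Fin 4 → OneForm I' P} (h : IsSeparating I pr ν) {p : P}
    {u v : TangentSpace I' p} (h₁ : mfderiv I' I pr p u = mfderiv I' I pr p v)
    (h₂ : connectionVector ν p u = connectionVector ν p v) : u = v := by
  rw [← sub_eq_zero]
  refine h p _ ?_ ?_
  · rw [map_sub, h₁]; exact sub_self _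
  · rw [map_sub, h₂, sub_self]

/-- With L = (d`pr`, `ν`) invertible, the lift is the conjugate L⁻¹(J × j)L. -/
theorem IsSeparating.exists_isLift [FiniteDimensional ℝ E] [FiniteDimensional ℝ E']
    (hdim : Module.finrank ℝ E' = Module.finrank ℝ E + 4) {pr : P → M}
    {ν : Fin 4 → OneForm I' P} (h : IsSeparating I pr ν) (J : EndField I M)
    (j : (Fin 4 → ℝ) →L[ℝ] (Fin 4 → ℝ)) : ∃ J' : EndField I' P, IsLift pr ν J j J' := by
  have hd : Module.finrank ℝ E' = Module.finrank ℝ (E × (Fin 4 → ℝ)) := by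
    rw [Module.finrank_prod, Module.finrank_fin_fun, hdim]
  have key : ∀ p, ∃ B : TangentSpace I' p →L[ℝ] TangentSpace I' p, ∀ v,
      mfderiv I' I pr p (B v) = J (pr p) (mfderiv I' I pr p v) ∧
      connectionVector ν p (B v) = j (connectionVector ν p v) := by
    intro p
    let L : E' →L[ℝ] E × (Fin 4 → ℝ) :=
      ((mfderiv I' I pr p).prod (connectionVector ν p) :
        TangentSpace I' p →L[ℝ] TangentSpace I (pr p) × (Fin 4 → ℝ))
    let K : E × (Fin 4 → ℝ) →L[ℝ] E × (Fin 4 → ℝ) :=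
      ((J (pr p)).prodMap j : TangentSpace I (pr p) × (Fin 4 → ℝ) →L[ℝ]
        TangentSpace I (pr p) × (Fin 4 → ℝ))
    have hL : L.IsInvertible := isInvertible_of_injective hd L fun v hv =>
      h p v (congrArg Prod.fst hv) (congrArg Prod.snd hv)
    refine ⟨(L.inverse.comp (K.comp L) : E' →L[ℝ] E'), fun v => ?_⟩
    have hv : L (L.inverse (K (L v))) = K (L v) := hL.self_apply_inverse _
    exact ⟨congrArg Prod.fst hv, congrArg Prod.snd hv⟩
  choose B hB using key
  exact ⟨B, fun p v => (hB p v).1, fun p v => (hB p v).2⟩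

variable (I) in
/-- The expression of `pr` in the preferred charts at `p₀` and at its image. -/
def projInChart (I' : ModelWithCorners ℝ E' H') (pr : P → M) (p₀ : P) (y : E') : E :=
  extChartAt I (pr p₀) (pr ((extChartAt I' p₀).symm y))

/-- The expression of the family of covectors `ν` in the preferred chart at `p₀`. -/
def connInChart (ν : Fin 4 → OneForm I' P) (p₀ : P) (y : E') : E' →L[ℝ] (Fin 4 → ℝ) :=
  ContinuousLinearMap.pi fun i => (ν i).inChart p₀ y

theorem projInChart_self (pr : P → M) (p₀ : P) :
    projInChart I I' pr p₀ (extChartAt I' p₀ p₀) = extChartAt I (pr p₀) (pr p₀) := by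
  rw [projInChart, extChartAt_to_inv]

variable [I.Boundaryless] [I'.Boundaryless] [IsManifold I ∞ M] [IsManifold I' ∞ P]

omit [IsManifold I ∞ M] [IsManifold I' ∞ P] [I.Boundaryless] in
theorem contDiffAt_projInChart {pr : P → M} (hpr : ContMDiff I' I ∞ pr) (p₀ : P) :
    ContDiffAt ℝ ∞ (projInChart I I' pr p₀) (extChartAt I' p₀ p₀) := by
  have h := (contMDiffAt_iff.1 (hpr p₀)).2
  rwa [I'.range_eq_univ, contDiffWithinAt_univ] at h

omit [IsManifold I ∞ M] [IsManifold I' ∞ P] [I.Boundaryless] in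
theorem eventually_mem_charts {pr : P → M} (hpr : ContMDiff I' I ∞ pr) (p₀ : P) :
    ∀ᶠ y in 𝓝 (extChartAt I' p₀ p₀), y ∈ (extChartAt I' p₀).target ∧
      pr ((extChartAt I' p₀).symm y) ∈ (extChartAt I (pr p₀)).source := by
  refine (eventually_mem_set.2 (extChartAt_target_mem_nhds p₀)).and ?_
  have h : ContinuousAt (fun y => pr ((extChartAt I' p₀).symm y)) (extChartAt I' p₀ p₀) :=
    hpr.continuous.continuousAt.comp (continuousAt_extChartAt_symm p₀)
  refine h.eventually_mem ?_
  rw [extChartAt_to_inv]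
  exact extChartAt_source_mem_nhds _

omit [I.Boundaryless] in
theorem fderiv_projInChart {pr : P → M} (hpr : ContMDiff I' I ∞ pr) {p₀ : P} {y : E'}
    (hy : y ∈ (extChartAt I' p₀).target)
    (hy' : pr ((extChartAt I' p₀).symm y) ∈ (extChartAt I (pr p₀)).source) (v : E') :
    fderiv ℝ (projInChart I I' pr p₀) y v = chartD I (pr p₀) (pr ((extChartAt I' p₀).symm y))
      (mfderiv I' I pr ((extChartAt I' p₀).symm y) (chartDSymm I' p₀ y v)) := by
  have : IsManifold I 1 M := IsManifold.of_le (n := ∞) (by norm_num)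
  have : IsManifold I' 1 P := IsManifold.of_le (n := ∞) (by norm_num)
  have h1 : MDifferentiableAt 𝓘(ℝ, E') I' (extChartAt I' p₀).symm y := by
    have := mdifferentiableWithinAt_extChartAt_symm hy
    rwa [I'.range_eq_univ, mdifferentiableWithinAt_univ] at this
  have h2 : MDifferentiableAt I' I pr ((extChartAt I' p₀).symm y) :=
    hpr.mdifferentiableAt (by simp)
  rw [extChartAt_source] at hy'
  have h3 : MDifferentiableAt I 𝓘(ℝ, E) (extChartAt I (pr p₀))
      (pr ((extChartAt I' p₀).symm y)) := mdifferentiableAt_extChartAt hy'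
  have h := mfderiv_comp y h3 (h2.comp y h1)
  rw [mfderiv_comp y h2 h1] at h
  rw [← mfderiv_eq_fderiv]
  exact DFunLike.congr_fun h v

theorem chartD_eq_zero {x₀ x : M} (hx : x ∈ (extChartAt I x₀).source) {v : TangentSpace I x}
    (h : chartD I x₀ x v = 0) : v = 0 := by
  obtain ⟨y, hy, rfl⟩ : ∃ y ∈ (extChartAt I x₀).target, (extChartAt I x₀).symm y = x :=
    ⟨_, (extChartAt I x₀).map_source hx, (extChartAt I x₀).left_inv hx⟩
  rw [← chartDSymm_chartD hy v, h, map_zero]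

theorem IsSeparating.inChart {pr : P → M} (hpr : ContMDiff I' I ∞ pr)
    {ν : Fin 4 → OneForm I' P} (h : IsSeparating I pr ν) {p₀ : P} {y : E'}
    (hy : y ∈ (extChartAt I' p₀).target)
    (hy' : pr ((extChartAt I' p₀).symm y) ∈ (extChartAt I (pr p₀)).source) {v : E'}
    (h₁ : fderiv ℝ (projInChart I I' pr p₀) y v = 0) (h₂ : connInChart ν p₀ y v = 0) : v = 0 := by
  rw [fderiv_projInChart hpr hy hy'] at h₁
  have := h _ (chartDSymm I' p₀ y v) (chartD_eq_zero hy' h₁) h₂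
  rw [← chartD_chartDSymm hy v, this, map_zero]

theorem IsLift.proj_inChart {pr : P → M} (hpr : ContMDiff I' I ∞ pr)
    {ν : Fin 4 → OneForm I' P} {J : EndField I M} {j : (Fin 4 → ℝ) →L[ℝ] (Fin 4 → ℝ)}
    {J' : EndField I' P} (h : IsLift pr ν J j J') {p₀ : P} {y : E'}
    (hy : y ∈ (extChartAt I' p₀).target)
    (hy' : pr ((extChartAt I' p₀).symm y) ∈ (extChartAt I (pr p₀)).source) :
    (fderiv ℝ (projInChart I I' pr p₀) y).comp (J'.inChart p₀ y)
      = (J.inChart (pr p₀) (projInChart I I' pr p₀ y)).comp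
        (fderiv ℝ (projInChart I I' pr p₀) y) := by
  ext v
  simp only [ContinuousLinearMap.comp_apply]
  rw [fderiv_projInChart hpr hy hy', fderiv_projInChart hpr hy hy', EndField.inChart,
    ContinuousLinearMap.comp_apply, chartDSymm_chartD hy, ContinuousLinearMap.comp_apply, h.proj,
    chartD_apply_endField J hy']
  rfl

omit [I.Boundaryless] [IsManifold I ∞ M] in
theorem IsLift.conn_inChart {pr : P → M}
    {ν : Fin 4 → OneForm I' P} {J : EndField I M} {j : (Fin 4 → ℝ) →L[ℝ] (Fin 4 → ℝ)}
    {J' : EndField I' P} (h : IsLift pr ν J j J') {p₀ : P} {y : E'}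
    (hy : y ∈ (extChartAt I' p₀).target) :
    (connInChart ν p₀ y).comp (J'.inChart p₀ y) = j.comp (connInChart ν p₀ y) := by
  have hc : ∀ v, connInChart ν p₀ y v
      = connectionVector ν ((extChartAt I' p₀).symm y) (chartDSymm I' p₀ y v) := fun v => rfl
  ext1 v
  simp only [ContinuousLinearMap.comp_apply]
  rw [hc, hc, EndField.inChart, ContinuousLinearMap.comp_apply, chartDSymm_chartD hy,
    ContinuousLinearMap.comp_apply, h.conn]

omit [I'.Boundaryless] [IsManifold I' ∞ P] in
theorem connInChart_eq_sum (ν : Fin 4 → OneForm I' P) (p₀ : P) :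
    connInChart ν p₀ = fun y => ∑ i, ((ν i).inChart p₀ y).smulRight (Pi.single i (1 : ℝ)) := by
  funext y
  ext v k
  simp [connInChart, Pi.single_apply]

omit [IsManifold I' ∞ P] in
theorem contDiffAt_connInChart {ν : Fin 4 → OneForm I' P}
    (hν : ∀ i, (ν i).toDForm.IsSmooth) (p₀ : P) :
    ContDiffAt ℝ ∞ (connInChart ν p₀) (extChartAt I' p₀ p₀) := by
  rw [connInChart_eq_sum]
  exact ContDiffAt.sum fun i _ =>
    (OneForm.contDiffAt_inChart (hν i) p₀).smulRight contDiffAt_const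

/-- In charts the lift is L⁻¹R, where L = (df, α) and R = (J df, j α) are smooth operator-valued
functions; inversion is smooth at invertible operators. -/
theorem IsLift.isSmooth [FiniteDimensional ℝ E] [FiniteDimensional ℝ E']
    (hdim : Module.finrank ℝ E' = Module.finrank ℝ E + 4)
    {pr : P → M} (hpr : ContMDiff I' I ∞ pr)
    {ν : Fin 4 → OneForm I' P} (hν : ∀ i, (ν i).toDForm.IsSmooth) (hsep : IsSeparating I pr ν)
    {J : EndField I M} (hJ : J.IsSmooth) {j : (Fin 4 → ℝ) →L[ℝ] (Fin 4 → ℝ)}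
    {J' : EndField I' P} (h : IsLift pr ν J j J') : J'.IsSmooth := by
  rw [EndField.isSmooth_iff] at hJ ⊢
  intro p₀
  have := FiniteDimensional.complete ℝ E'
  have hd : Module.finrank ℝ E' = Module.finrank ℝ (E × (Fin 4 → ℝ)) := by
    rw [Module.finrank_prod, Module.finrank_fin_fun, hdim]
  set f := projInChart I I' pr p₀
  have hf : ContDiffAt ℝ ∞ f (extChartAt I' p₀ p₀) := contDiffAt_projInChart hpr p₀
  have hdf : ContDiffAt ℝ ∞ (fderiv ℝ f) (extChartAt I' p₀ p₀) := hf.fderiv_right (by norm_num)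
  have hα := contDiffAt_connInChart hν p₀
  have hJf : ContDiffAt ℝ ∞ (fun y => J.inChart (pr p₀) (f y)) (extChartAt I' p₀ p₀) := by
    have := hJ (pr p₀)
    rw [← projInChart_self (I' := I')] at this
    exact this.comp _ hf
  let inl := ContinuousLinearMap.inl ℝ E (Fin 4 → ℝ)
  let inr := ContinuousLinearMap.inr ℝ E (Fin 4 → ℝ)
  let L : E' → E' →L[ℝ] E × (Fin 4 → ℝ) := fun y =>
    inl.comp (fderiv ℝ f y) + inr.comp (connInChart ν p₀ y)
  let R : E' → E' →L[ℝ] E × (Fin 4 → ℝ) := fun y =>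
    inl.comp ((J.inChart (pr p₀) (f y)).comp (fderiv ℝ f y))
      + inr.comp (j.comp (connInChart ν p₀ y))
  have hLs : ContDiffAt ℝ ∞ L (extChartAt I' p₀ p₀) :=
    (contDiffAt_const.clm_comp hdf).add (contDiffAt_const.clm_comp hα)
  have hRs : ContDiffAt ℝ ∞ R (extChartAt I' p₀ p₀) :=
    (contDiffAt_const.clm_comp (hJf.clm_comp hdf)).add
      (contDiffAt_const.clm_comp (contDiffAt_const.clm_comp hα))
  have hL : ∀ᶠ y in 𝓝 (extChartAt I' p₀ p₀), (L y).IsInvertible := by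
    filter_upwards [eventually_mem_charts hpr p₀] with y hy
    refine isInvertible_of_injective hd _ fun v hv => ?_
    have h1 : fderiv ℝ f y v = 0 := by simpa [L, inl, inr] using congrArg Prod.fst hv
    have h2 : connInChart ν p₀ y v = 0 := by simpa [L, inl, inr] using congrArg Prod.snd hv
    exact hsep.inChart hpr hy.1 hy.2 h1 h2
  have hinv : ContDiffAt ℝ ∞ (fun y => (L y).inverse) (extChartAt I' p₀ p₀) :=
    hL.self_of_nhds.contDiffAt_map_inverse.comp (extChartAt I' p₀ p₀) hLs
  refine (hinv.clm_comp hRs).congr_of_eventuallyEq ?_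
  filter_upwards [eventually_mem_charts hpr p₀, hL] with y hy hLy
  have hLR : (L y).comp (J'.inChart p₀ y) = R y := by
    simp only [L, R, ContinuousLinearMap.add_comp, ContinuousLinearMap.comp_assoc]
    rw [h.proj_inChart hpr hy.1 hy.2, h.conn_inChart hy.1]
  rw [← hLR, ← ContinuousLinearMap.comp_assoc, hLy.inverse_comp_self, ContinuousLinearMap.id_comp]

omit [I.Boundaryless] [I'.Boundaryless] [IsManifold I ∞ M] [IsManifold I' ∞ P] in
theorem IsLift.sq {pr : P → M} {ν : Fin 4 → OneForm I' P} (hsep : IsSeparating I pr ν)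
    {J : EndField I M} (hJ : ∀ x (v : TangentSpace I x), J x (J x v) = -v)
    {j : (Fin 4 → ℝ) →L[ℝ] (Fin 4 → ℝ)} (hj : ∀ a, j (j a) = -a)
    {J' : EndField I' P} (h : IsLift pr ν J j J') (p : P) (v : TangentSpace I' p) :
    J' p (J' p v) = -v := by
  refine hsep.ext ?_ ?_
  · rw [h.proj, h.proj, hJ, map_neg]
  · rw [h.conn, h.conn, hj, map_neg]

theorem EndField.inChart_sq {J : EndField I M} (hJ : ∀ x (v : TangentSpace I x), J x (J x v) = -v)
    (x₀ : M) : ∀ᶠ y in 𝓝 (extChartAt I x₀ x₀), ∀ v, J.inChart x₀ y (J.inChart x₀ y v) = -v := by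
  filter_upwards [extChartAt_target_mem_nhds (I := I) x₀] with y hy v
  simp only [EndField.inChart, ContinuousLinearMap.comp_apply]
  rw [chartDSymm_chartD hy, hJ, map_neg, chartD_chartDSymm hy]

theorem IsLift.isIntegrable [FiniteDimensional ℝ E] [FiniteDimensional ℝ E']
    {pr : P → M} (hpr : ContMDiff I' I ∞ pr)
    {ν : Fin 4 → OneForm I' P} (hν : ∀ i, (ν i).toDForm.IsSmooth) (hsep : IsSeparating I pr ν)
    {J : EndField I M} (hJ : J.IsSmooth) (hJJ : ∀ x (v : TangentSpace I x), J x (J x v) = -v)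
    (hJi : J.IsIntegrable)
    {j : (Fin 4 → ℝ) →L[ℝ] (Fin 4 → ℝ)} (hj : ∀ a, j (j a) = -a)
    {J' : EndField I' P} (h : IsLift pr ν J j J') (hJ' : J'.IsSmooth)
    {γ : Fin 4 → DForm I M 2} (hcurv : ∀ i, (ν i).toDForm.d = (γ i).pullback pr)
    (hγ : ∀ i x (u v : TangentSpace I x), γ i x ![J x u, J x v] = γ i x ![u, v]) :
    J'.IsIntegrable := by
  have := FiniteDimensional.complete ℝ E'
  have := FiniteDimensional.complete ℝ E
  refine EndField.isIntegrable_of_inChart fun p₀ X Y hX hY => ?_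
  have hg := eventually_mem_charts hpr p₀
  have hα : DifferentiableAt ℝ (connInChart ν p₀) (extChartAt I' p₀ p₀) :=
    (contDiffAt_connInChart hν p₀).differentiableAt (by simp)
  refine nijenhuis_eq_zero (f := projInChart I I' pr p₀) (J := J.inChart (pr p₀))
    (α := connInChart ν p₀) j
    ((contDiffAt_projInChart hpr p₀).of_le (WithTop.coe_le_coe.2 (le_top : (2 : ℕ∞) ≤ ⊤))) ?_ hα
    ((EndField.isSmooth_iff.1 hJ' p₀).differentiableAt (by simp)) ?_
    (EndField.inChart_sq (h.sq hsep hJJ hj) p₀) ?_ ?_ ?_ ?_ ?_ hX hY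
  · rw [projInChart_self]
    exact (EndField.isSmooth_iff.1 hJ (pr p₀)).differentiableAt (by simp)
  · rw [projInChart_self]
    exact EndField.inChart_sq hJJ (pr p₀)
  · filter_upwards [hg] with y hy using h.proj_inChart hpr hy.1 hy.2
  · filter_upwards [hg] with y hy using h.conn_inChart hy.1
  · intro u v
    rw [projInChart_self]
    exact hJi.nijenhuis_inChart (pr p₀) u v
  -- The curvature at `p₀` is pulled back from `M`; the lift covers `J`, and `γ` is `J`-invariant,
  -- so the curvature is invariant under the lift.
  · have key : ∀ u v : TangentSpace I' p₀, curl (connInChart ν p₀) (extChartAt I' p₀ p₀)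
        (chartD I' p₀ p₀ u) (chartD I' p₀ p₀ v) = fun i =>
          γ i (pr p₀) ![mfderiv I' I pr p₀ u, mfderiv I' I pr p₀ v] := by
      intro u v
      funext i
      rw [← DForm.pullback_apply_two, ← hcurv i, ← OneForm.curl_inChart]
      exact (curl_const_comp (ContinuousLinearMap.proj (R := ℝ) (φ := fun _ : Fin 4 => ℝ) i) hα
        _ _).symm
    intro u v
    obtain ⟨u, rfl⟩ : ∃ u' : TangentSpace I' p₀, chartD I' p₀ p₀ u' = u := ⟨u, chartD_self p₀ u⟩
    obtain ⟨v, rfl⟩ : ∃ v' : TangentSpace I' p₀, chartD I' p₀ p₀ v' = v := ⟨v, chartD_self p₀ v⟩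
    rw [← chartD_apply_endField J' (mem_extChartAt_source p₀),
      ← chartD_apply_endField J' (mem_extChartAt_source p₀), key, key]
    funext i
    rw [h.proj, h.proj, hγ]
  · intro v
    exact hsep.inChart hpr hg.self_of_nhds.1 hg.self_of_nhds.2

end Lift

/-! ### The lifted metric and fundamental forms -/

section Metric

variable {E : Type*} [NormedAddCommGroup E] [NormedSpace ℝ E]
  {H : Type*} [TopologicalSpace H] {I : ModelWithCorners ℝ E H} [I.Boundaryless]
  {M : Type*} [TopologicalSpace M] [ChartedSpace H M] [IsManifold I ∞ M]
  {E' : Type*} [NormedAddCommGroup E'] [NormedSpace ℝ E'] [FiniteDimensional ℝ E']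
  {H' : Type*} [TopologicalSpace H'] {I' : ModelWithCorners ℝ E' H'} [I'.Boundaryless]
  {P : Type*} [TopologicalSpace P] [ChartedSpace H' P] [IsManifold I' ∞ P]

omit [FiniteDimensional ℝ E'] in
theorem contDiffAt_liftedMetric_inChart {pr : P → M} (hpr : ContMDiff I' I ∞ pr)
    {ν : Fin 4 → OneForm I' P} (hν : ∀ i, (ν i).toDForm.IsSmooth) {g : BilinField I M}
    (hg : ∀ x₀, ContDiffAt ℝ ∞ (g.inChart x₀) (extChartAt I x₀ x₀)) (p₀ : P) :
    ContDiffAt ℝ ∞ ((liftedMetric pr g ν).inChart p₀) (extChartAt I' p₀ p₀) := by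
  set f := projInChart I I' pr p₀
  have hf : ContDiffAt ℝ ∞ f (extChartAt I' p₀ p₀) := contDiffAt_projInChart hpr p₀
  have hdf : ContDiffAt ℝ ∞ (fderiv ℝ f) (extChartAt I' p₀ p₀) := hf.fderiv_right (by norm_num)
  have hgf : ContDiffAt ℝ ∞ (fun y => g.inChart (pr p₀) (f y)) (extChartAt I' p₀ p₀) := by
    have := hg (pr p₀)
    rw [← projInChart_self (I' := I')] at this
    exact this.comp _ hf
  -- Precomposition depends linearly and continuously on the map composed with, hence smoothly.
  let C : (E' →L[ℝ] E) →L[ℝ] (E →L[ℝ] ℝ) →L[ℝ] E' →L[ℝ] ℝ :=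
    (ContinuousLinearMap.compL ℝ E' E ℝ).flip
  have hC : ContDiff ℝ ∞ C := by fun_prop
  have hprecomp : ContDiffAt ℝ ∞ (fun y => ContinuousLinearMap.precomp ℝ (fderiv ℝ f y))
      (extChartAt I' p₀ p₀) := hC.contDiffAt.comp (extChartAt I' p₀ p₀) hdf
  have hνc := fun i => OneForm.contDiffAt_inChart (hν i) p₀
  have h1 := hprecomp.clm_comp (hgf.clm_comp hdf)
  have h2 : ContDiffAt ℝ ∞
      (fun y => ∑ i, ((ν i).inChart p₀ y).smulRight ((ν i).inChart p₀ y))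
      (extChartAt I' p₀ p₀) := ContDiffAt.sum fun i _ => (hνc i).smulRight (hνc i)
  refine (h1.add h2).congr_of_eventuallyEq ?_
  filter_upwards [eventually_mem_charts hpr p₀] with y hy
  ext u v
  have e : (liftedMetric pr g ν).inChart p₀ y u v
      = liftedMetric pr g ν ((extChartAt I' p₀).symm y) (chartDSymm I' p₀ y u)
        (chartDSymm I' p₀ y v) := rfl
  rw [e, liftedMetric_apply, bilinField_apply_eq g hy.2]
  simp only [add_apply, sum_apply, ContinuousLinearMap.comp_apply,
    ContinuousLinearMap.precomp_apply, ContinuousLinearMap.smulRight_apply, smul_apply,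
    smul_eq_mul]
  rw [fderiv_projInChart hpr hy.1 hy.2, fderiv_projInChart hpr hy.1 hy.2]
  rfl

theorem IsRiemannianMetric.liftedMetric {pr : P → M} (hpr : ContMDiff I' I ∞ pr)
    {ν : Fin 4 → OneForm I' P} (hν : ∀ i, (ν i).toDForm.IsSmooth) (hsep : IsSeparating I pr ν)
    {g : BilinField I M} (hg : IsRiemannianMetric g) :
    IsRiemannianMetric (liftedMetric pr g ν) := by
  obtain ⟨G, hG⟩ := hg
  have hpos : ∀ p (v : TangentSpace I' p), v ≠ 0 → 0 < HKTorus.liftedMetric pr g ν p v v := by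
    intro p v hv
    rw [liftedMetric_apply, ← hG]
    have h2 : ∀ i ∈ Finset.univ, 0 ≤ ν i p v * ν i p v := fun i _ => mul_self_nonneg _
    -- A nonzero vertical vector has a nonzero `ν`-component by separation; any other has positive
    -- length already on the base.
    by_cases h : mfderiv I' I pr p v = 0
    · have hc : connectionVector ν p v ≠ 0 := fun hc => hv (hsep p v h hc)
      obtain ⟨i, hi⟩ := Function.ne_iff.1 hc
      rw [h, map_zero, zero_add]
      exact Finset.sum_pos' h2 ⟨i, Finset.mem_univ i, mul_self_pos.2 hi⟩
    · exact add_pos_of_pos_of_nonneg (G.pos _ _ h) (Finset.sum_nonneg h2)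
  refine ⟨⟨HKTorus.liftedMetric pr g ν, fun p u v => ?_, hpos, fun p => ?_, ?_⟩, fun p => rfl⟩
  · rw [liftedMetric_apply, liftedMetric_apply, ← hG, G.symm]
    simp only [mul_comm]
  · exact isVonNBounded_of_posDef (V := E') (HKTorus.liftedMetric pr g ν p) (hpos p)
  · refine BilinField.contMDiff_iff.2 (contDiffAt_liftedMetric_inChart hpr hν ?_)
    have h := G.contMDiff
    simp only [hG] at h
    exact BilinField.contMDiff_iff.1 h

omit [I.Boundaryless] [IsManifold I ∞ M] in
theorem IsSpForm.invariant {J : Fin 3 → EndField I M} {γ : DForm I M 2} (h : IsSpForm J γ)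
    (i : Fin 3) (x : M) (u v : TangentSpace I x) : γ x ![J i x u, J i x v] = γ x ![u, v] := by
  fin_cases i
  · simpa using h 1 0 0 (by norm_num) x u v
  · simpa using h 0 1 0 (by norm_num) x u v
  · simpa using h 0 0 1 (by norm_num) x u v

-- The signs in the wedge terms are those of left quaternion multiplication: the vertical part is ⟨j
-- a, b⟩ for the Euclidean product on `ℝ⁴`.
omit [I.Boundaryless] [IsManifold I ∞ M] [FiniteDimensional ℝ E'] [I'.Boundaryless]
  [IsManifold I' ∞ P] in
theorem liftedForms_apply (pr : P → M) (σ : Fin 3 → DForm I M 2) (ν : Fin 4 → OneForm I' P)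
    (i : Fin 3) (p : P) (u v : TangentSpace I' p) :
    liftedForms pr σ ν i p ![u, v]
      = σ i (pr p) ![mfderiv I' I pr p u, mfderiv I' I pr p v]
        + ∑ k, fiberJ i (connectionVector ν p u) k * connectionVector ν p v k := by
  have hadd : ∀ (a b c : DForm I' P 2), (a + b + c) p ![u, v]
      = a p ![u, v] + b p ![u, v] + c p ![u, v] := fun a b c => rfl
  have hw : ∀ a b : OneForm I' P, a.wedge b p ![u, v] = a p u * b p v - a p v * b p u :=
    fun a b => wedgeCovector_apply _ _ _ _
  have hc : ∀ k w, connectionVector ν p w k = ν k p w := fun k w => rfl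
  fin_cases i
  · change ((σ 0).pullback pr + (ν 0).wedge (ν 1) + (ν 2).wedge (ν 3) : DForm I' P 2) p ![u, v] = _
    rw [hadd, hw, hw, DForm.pullback_apply_two]
    simp [fiberJ_zero_apply, Fin.sum_univ_four, hc]
    ring
  · change ((σ 1).pullback pr + (ν 0).wedge (ν 2) + (ν 3).wedge (ν 1) : DForm I' P 2) p ![u, v] = _
    rw [hadd, hw, hw, DForm.pullback_apply_two]
    simp [fiberJ_one_apply, Fin.sum_univ_four, hc]
    ring
  · change ((σ 2).pullback pr + (ν 0).wedge (ν 3) + (ν 1).wedge (ν 2) : DForm I' P 2) p ![u, v] = _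
    rw [hadd, hw, hw, DForm.pullback_apply_two]
    simp [fiberJ_two_apply, Fin.sum_univ_four, hc]
    ring

end Metric

end HKTorus

end

/-! ### The hyper-Hermitian structure on the total space -/

theorem mainTheorem3 {n : ℕ}
    {E : Type*} [NormedAddCommGroup E] [NormedSpace ℝ E] [FiniteDimensional ℝ E]
    (hE : Module.finrank ℝ E = 4 * n)
    {H : Type*} [TopologicalSpace H] (I : ModelWithCorners ℝ E H) [I.Boundaryless]
    {M : Type*} [TopologicalSpace M] [T2Space M] [SecondCountableTopology M]
    [ChartedSpace H M] [IsManifold I ∞ M]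
    {E' : Type*} [NormedAddCommGroup E'] [NormedSpace ℝ E'] [FiniteDimensional ℝ E']
    (hE' : Module.finrank ℝ E' = 4 * n + 4)
    {H' : Type*} [TopologicalSpace H'] (I' : ModelWithCorners ℝ E' H') [I'.Boundaryless]
    {P : Type*} [TopologicalSpace P] [T2Space P] [SecondCountableTopology P]
    [ChartedSpace H' P] [IsManifold I' ∞ P] [MulAction HKTorus.Torus4 P]
    (g : HKTorus.BilinField I M) (J : Fin 3 → HKTorus.EndField I M)
    (σ : Fin 3 → HKTorus.DForm I M 2) (hM : HKTorus.IsHyperKahler g J σ)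
    (γ : Fin 4 → HKTorus.DForm I M 2) (hγ_smooth : ∀ i, (γ i).IsSmooth)
    (hγ_closed : ∀ i, (γ i).IsClosed) (hγ_sp : ∀ i, HKTorus.IsSpForm J (γ i))
    (pr : P → M) (hpr : HKTorus.IsPrincipalTorusBundle I I' pr)
    (ν : Fin 4 → HKTorus.OneForm I' P) (hν : HKTorus.IsConnectionForm ν)
    (hν_curv : ∀ i, (ν i).toDForm.d = (γ i).pullback pr) :
    ∃ J' : Fin 3 → HKTorus.EndField I' P,
      HKTorus.IsHyperHermitian (HKTorus.liftedMetric pr g ν) J' (HKTorus.liftedForms pr σ ν) := by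
  have hdim : Module.finrank ℝ E' = Module.finrank ℝ E + 4 := by rw [hE, hE']
  have hpr' : ContMDiff I' I ∞ pr := hpr.smooth_proj
  have hsep : HKTorus.IsSeparating I pr ν := fun p v =>
    HKTorus.eq_zero_of_vertical_of_horizontal hdim hpr hν p v
  obtain ⟨-, hJ, hherm, hform⟩ := hM.toIsHyperHermitian
  choose J' hJ' using fun i => hsep.exists_isLift hdim (J i) (HKTorus.fiberJ i)
  have hsmooth : ∀ i, (J' i).IsSmooth := fun i =>
    (hJ' i).isSmooth hdim hpr' hν.smooth hsep (hJ.smooth i)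
  refine ⟨J', hM.riemannian.liftedMetric hpr' hν.smooth hsep,
    ⟨hsmooth, fun i => (hJ' i).sq hsep (hJ.sq i) (HKTorus.fiberJ_sq i), fun i p v => ?_,
      fun i p v => ?_, fun i => ?_⟩, fun i p u v => ?_, fun i p u v => ?_⟩
  · refine hsep.ext ?_ ?_
    · rw [(hJ' i).proj, (hJ' (i + 1)).proj, (hJ' (i + 2)).proj, hJ.mul]
    · rw [(hJ' i).conn, (hJ' (i + 1)).conn, (hJ' (i + 2)).conn, HKTorus.fiberJ_mul]
  · refine hsep.ext ?_ ?_
    · rw [map_neg, (hJ' i).proj, (hJ' (i + 1)).proj, (hJ' (i + 1)).proj, (hJ' i).proj, hJ.anticomm]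
    · rw [map_neg, (hJ' i).conn, (hJ' (i + 1)).conn, (hJ' (i + 1)).conn, (hJ' i).conn,
        HKTorus.fiberJ_anticomm]
  · exact (hJ' i).isIntegrable hpr' hν.smooth hsep (hJ.smooth i) (hJ.sq i) (hJ.integrable i)
      (HKTorus.fiberJ_sq i) (hsmooth i) hν_curv fun k => (hγ_sp k).invariant i
  · rw [HKTorus.liftedMetric_apply, HKTorus.liftedMetric_apply, (hJ' i).proj, (hJ' i).proj, hherm]
    refine congrArg (_ + ·) ?_
    have h := HKTorus.fiberJ_orthogonal i (HKTorus.connectionVector ν p u)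
      (HKTorus.connectionVector ν p v)
    rwa [← (hJ' i).conn, ← (hJ' i).conn] at h
  · rw [HKTorus.liftedForms_apply, HKTorus.liftedMetric_apply, hform, (hJ' i).proj,
      ← (hJ' i).conn]
    rfl
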